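/- For a finite simple graph $G$ let $\Delta(G)$ be its maximum degree and let its $m$-degree $m(G)$ be the largest integer $i$ such that $G$ has $i$ vertices of degree at least $i-1$. A $b$-coloring of $G$ with $k$ colors is a proper coloring $c\colon V(G)\to\{1,\dots,k\}$ such that for every color $i$ there is a vertex $x_i$ with $c(x_i)=i$ that has, for every color $j\neq i$, a neighbor of color $j$. Consider the problem of deciding whether a given graph $G$ has a $b$-coloring with $m(G)$ colors, parameterized by $\Delta(G)$; as a parameterized problem it is the set $\Pi\subseteq\{0,1\}^*\times\mathbb N$ of all pairs $(x,d)$ such that $x$ is the adjacency matrix of a graph $G$ with $d=\Delta(G)$ that has a $b$-coloring with $m(G)$ colors. A kernelization algorithm for $\Pi$ is a polynomial-time algorithm that on every input $(x,d)\in\{0,1\}^*\times\mathbb N$ either correctly decides whether $(x,d)\in\Pi$, or outputs a pair $(x',d')$ with $|x'|+d'\le f(d)$ for a fixed computable function $f$, such that $(x,d)\in\Pi$ if and only if $(x',d')\in\Pi$. Then $\Pi$ admits a kernel on $O(k^4\cdot\Delta)=O(\Delta^5)$ vertices, where $k=m(G)$ and $\Delta=\Delta(G)$. That is, there are a kernelization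 algorithm for $\Pi$ and a constant $C$ such that, whenever the algorithm, given a graph $G$ together with its parameter $\Delta(G)$, does not decide the instance itself, it outputs a graph $G'$ together with its parameter $\Delta(G')$, and $$|V(G')|\le C\cdot m(G)^4\cdot\Delta(G)\qquad\text{and}\qquad |V(G')|\le C\cdot\Delta(G)^5 .$$ -/

import Mathlib

/-! ## b-colorings and the m-degree -/

namespace SimpleGraph

/-- A proper coloring `c` of `G` with the colors `Fin k` is a b-coloring if every color `i` has a
b-vertex: a vertex of color `i` that has a neighbor of every other color. -/
def IsBColoring {V : Type*} {G : SimpleGraph V} {k : ℕ} (c : G.Coloring (Fin k)) : Prop :=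
  ∀ i : Fin k, ∃ x : V, c x = i ∧ ∀ j : Fin k, j ≠ i → ∃ y : V, G.Adj x y ∧ c y = j

/-- `G` has a b-coloring with `k` colors. -/
def HasBColoring {V : Type*} (G : SimpleGraph V) (k : ℕ) : Prop :=
  ∃ c : G.Coloring (Fin k), IsBColoring c

open Classical in
/-- The maximum degree `Δ(G)` (it is `0` for the graph without vertices). -/
noncomputable def maxDeg {V : Type*} [Fintype V] (G : SimpleGraph V) : ℕ :=
  G.maxDegree

open Classical in
/-- The number of vertices `v` with `deg v ≥ i - 1` (subtraction in the integers). -/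
noncomputable def numDegGePred {V : Type*} [Fintype V] (G : SimpleGraph V) (i : ℕ) : ℕ :=
  (Finset.univ.filter fun v : V => i ≤ G.degree v + 1).card

/-- The m-degree `m(G)`: the largest `i` such that `G` has `i` vertices of degree at least
`i - 1`. -/
noncomputable def mDegree {V : Type*} [Fintype V] (G : SimpleGraph V) : ℕ :=
  sSup {i : ℕ | i ≤ G.numDegGePred i}

/-- The supremum in the definition of the m-degree is a maximum. -/
theorem mDegree_isGreatest {V : Type*} [Fintype V] (G : SimpleGraph V) :
    IsGreatest {i : ℕ | i ≤ G.numDegGePred i} G.mDegree := by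
  have hb : BddAbove {i : ℕ | i ≤ G.numDegGePred i} :=
    ⟨Fintype.card V, fun i hi => le_trans hi (Finset.card_le_univ _)⟩
  have hne : {i : ℕ | i ≤ G.numDegGePred i}.Nonempty := ⟨0, Nat.zero_le _⟩
  exact ⟨Nat.sSup_mem hne hb, fun i hi => le_csSup hb hi⟩

end SimpleGraph

/-! ## Random access machines with a step count -/

namespace RAM

/-- A configuration: registers and an indirectly addressable memory, all cells holding natural
numbers. -/
structure Config where
  reg : ℕ → ℕ
  mem : ℕ → ℕ

/-- `c.setReg r v` writes `v` into register `r`. -/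
def Config.setReg (c : Config) (r v : ℕ) : Config :=
  { c with reg := Function.update c.reg r v }

/-- `c.setMem a v` writes `v` into the memory cell with address `a`. -/
def Config.setMem (c : Config) (a v : ℕ) : Config :=
  { c with mem := Function.update c.mem a v }

/-- Random access machine programs. The only arithmetic is addition and truncated subtraction, so
the unit-cost measure below agrees with Turing machine time up to a polynomial. -/
inductive Program : Type
  /-- do nothing -/
  | skip : Program
  /-- `reg r := n` -/
  | const (r n : ℕ) : Program
  /-- `reg r := reg s + reg t` -/
  | add (r s t : ℕ) : Program
  /-- `reg r := reg s - reg t`, truncated at `0` -/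
  | sub (r s t : ℕ) : Program
  /-- `reg r := mem (reg s)` -/
  | load (r s : ℕ) : Program
  /-- `mem (reg r) := reg s` -/
  | store (r s : ℕ) : Program
  /-- first `p`, then `q` -/
  | seq (p q : Program) : Program
  /-- if `reg r ≠ 0` then `p` else `q` -/
  | cond (r : ℕ) (p q : Program) : Program
  /-- while `reg r ≠ 0` do `p` -/
  | loop (r : ℕ) (p : Program) : Program

/-- `Exec p c t d`: the program `p`, started in the configuration `c`, halts in the configuration
`d` after exactly `t` steps. Every elementary instruction and every test costs one step. -/
inductive Exec : Program → Config → ℕ → Config → Prop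
  | skip (c : Config) : Exec Program.skip c 1 c
  | const (r n : ℕ) (c : Config) : Exec (Program.const r n) c 1 (c.setReg r n)
  | add (r s t : ℕ) (c : Config) :
      Exec (Program.add r s t) c 1 (c.setReg r (c.reg s + c.reg t))
  | sub (r s t : ℕ) (c : Config) :
      Exec (Program.sub r s t) c 1 (c.setReg r (c.reg s - c.reg t))
  | load (r s : ℕ) (c : Config) : Exec (Program.load r s) c 1 (c.setReg r (c.mem (c.reg s)))
  | store (r s : ℕ) (c : Config) : Exec (Program.store r s) c 1 (c.setMem (c.reg r) (c.reg s))
  | seq {p q : Program} {c d e : Config} {t u : ℕ} (hp : Exec p c t d) (hq : Exec q d u e) :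
      Exec (Program.seq p q) c (t + u) e
  | cond_pos {r : ℕ} {p q : Program} {c d : Config} {t : ℕ} (hr : c.reg r ≠ 0)
      (hp : Exec p c t d) : Exec (Program.cond r p q) c (t + 1) d
  | cond_zero {r : ℕ} {p q : Program} {c d : Config} {t : ℕ} (hr : c.reg r = 0)
      (hq : Exec q c t d) : Exec (Program.cond r p q) c (t + 1) d
  | loop_done {r : ℕ} {p : Program} {c : Config} (hr : c.reg r = 0) :
      Exec (Program.loop r p) c 1 c
  | loop_step {r : ℕ} {p : Program} {c d e : Config} {t u : ℕ} (hr : c.reg r ≠ 0)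
      (hp : Exec p c t d) (hl : Exec (Program.loop r p) d u e) :
      Exec (Program.loop r p) c (t + u + 1) e

/-- Execution is deterministic. -/
theorem Exec.deterministic {p : Program} {c d d' : Config} {t t' : ℕ} (h : Exec p c t d)
    (h' : Exec p c t' d') : t = t' ∧ d = d' := by
  induction h generalizing t' d' with
  | skip c => cases h'; exact ⟨rfl, rfl⟩
  | const r n c => cases h'; exact ⟨rfl, rfl⟩
  | add r s t c => cases h'; exact ⟨rfl, rfl⟩
  | sub r s t c => cases h'; exact ⟨rfl, rfl⟩
  | load r s c => cases h'; exact ⟨rfl, rfl⟩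
  | store r s c => cases h'; exact ⟨rfl, rfl⟩
  | seq hp hq ihp ihq =>
    cases h' with
    | seq hp' hq' =>
      obtain ⟨rfl, rfl⟩ := ihp hp'
      obtain ⟨rfl, rfl⟩ := ihq hq'
      exact ⟨rfl, rfl⟩
  | cond_pos hr hp ih =>
    cases h' with
    | cond_pos hr' hp' =>
      obtain ⟨rfl, rfl⟩ := ih hp'
      exact ⟨rfl, rfl⟩
    | cond_zero hr' hp' => exact absurd hr' hr
  | cond_zero hr hp ih =>
    cases h' with
    | cond_pos hr' hp' => exact absurd hr hr'
    | cond_zero hr' hp' =>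
      obtain ⟨rfl, rfl⟩ := ih hp'
      exact ⟨rfl, rfl⟩
  | loop_done hr =>
    cases h' with
    | loop_done hr' => exact ⟨rfl, rfl⟩
    | loop_step hr' hp' hl' => exact absurd hr hr'
  | loop_step hr hp hl ihp ihl =>
    cases h' with
    | loop_done hr' => exact absurd hr' hr
    | loop_step hr' hp' hl' =>
      obtain ⟨rfl, rfl⟩ := ihp hp'
      obtain ⟨rfl, rfl⟩ := ihl hl'
      exact ⟨rfl, rfl⟩

end RAM

/-! ## Parameterized problems and kernelization algorithms -/

namespace Parameterized

/-- A parameterized problem over the alphabet `Bool`. -/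
abbrev Problem : Type := Set (List Bool × ℕ)

/-- What a kernelization algorithm may answer: "yes", "no", or a new instance. -/
inductive Outcome : Type
  | accept : Outcome
  | reject : Outcome
  | reduced (x : List Bool) (k : ℕ) : Outcome

/-- The size of an answer. -/
def Outcome.size : Outcome → ℕ
  | Outcome.accept => 1
  | Outcome.reject => 1
  | Outcome.reduced x k => x.length + k

/-- The input `(x, k)`: register `0` holds the length of `x`, register `1` holds `k`, memory cell
`i` holds the `i`-th bit of `x`; everything else is `0`. -/
def inputConfig (x : List Bool) (k : ℕ) : RAM.Config where
  reg := fun r => if r = 0 then x.length else if r = 1 then k else 0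
  mem := fun i => if x.getD i false = true then 1 else 0

/-- The answer in a final configuration: register `0` holds `0` for "no", `1` for "yes", and any
other value for a new instance `(x', k')`, where register `1` holds the length of `x'`, register `2`
holds `k'`, and the `i`-th bit of `x'` is set if and only if memory cell `i` is nonzero. -/
def outcomeOf (c : RAM.Config) : Outcome :=
  if c.reg 0 = 0 then Outcome.reject
  else if c.reg 0 = 1 then Outcome.accept
  else Outcome.reduced ((List.range (c.reg 1)).map fun i => decide (c.mem i ≠ 0)) (c.reg 2)

/-- On the input `(x, k)` the program `P` halts after `t` steps with the answer `o`. -/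
def Answers (P : RAM.Program) (x : List Bool) (k t : ℕ) (o : Outcome) : Prop :=
  ∃ d : RAM.Config, RAM.Exec P (inputConfig x k) t d ∧ outcomeOf d = o

/-- `P` runs in polynomial time: on every input it halts, and the number of steps together with the
size of the answer is bounded by a polynomial in the size of the input. -/
def RunsInPolyTime (P : RAM.Program) : Prop :=
  ∃ a : ℕ, ∀ (x : List Bool) (k : ℕ), ∃ (t : ℕ) (o : Outcome),
    Answers P x k t o ∧ t + o.size ≤ a * (x.length + k + 1) ^ a

/-- The answer `o` on the instance `(x, k)` of `Q` is right, and if it is a new instance `(x', k')`,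
then `|x'| + k' ≤ f k`. -/
def Outcome.IsCorrect (Q : Problem) (f : ℕ → ℕ) (x : List Bool) (k : ℕ) : Outcome → Prop
  | Outcome.accept => (x, k) ∈ Q
  | Outcome.reject => (x, k) ∉ Q
  | Outcome.reduced x' k' => x'.length + k' ≤ f k ∧ ((x, k) ∈ Q ↔ (x', k') ∈ Q)

/-- `P` is a kernelization algorithm for the parameterized problem `Q`. -/
def IsKernelization (P : RAM.Program) (Q : Problem) : Prop :=
  RunsInPolyTime P ∧
    ∃ f : ℕ → ℕ, Computable f ∧
      ∀ (x : List Bool) (k t : ℕ) (o : Outcome), Answers P x k t o → o.IsCorrect Q f x k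

open Classical in
/-- A graph on `n` vertices is written as its adjacency matrix, row by row. -/
noncomputable def encodeGraph {n : ℕ} (G : SimpleGraph (Fin n)) : List Bool :=
  List.ofFn fun i : Fin (n * n) => decide (G.Adj i.divNat i.modNat)

/-- The problem of deciding whether a graph `G` has a b-coloring with `m(G)` colors, parameterized
by the maximum degree of `G`. -/
def mDegreeBColoring : Problem :=
  {I | ∃ (n : ℕ) (G : SimpleGraph (Fin n)),
    I = (encodeGraph G, G.maxDeg) ∧ G.HasBColoring G.mDegree}

end Parameterized

/-! Write `k = m(G)` and `Δ = Δ(G)`. Call a vertex dense, high or tight if its degree is at least `k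
- 1`, at least `k`, or exactly `k - 1`. A b-vertex sees `k - 1` colors besides its own, so it is
dense, and only the closed neighborhood `N` of the dense vertices matters. The induced graph on `N`
has the same m-degree and the same maximum degree. A b-coloring of `G` restricts to it. Conversely,
one of the induced graph extends greedily, since vertices outside `N` have degree below `k`
(`hasBColoring_comap_iff`).

It remains to answer "yes" when `N` has more than `6 * (k ^ 4 * Δ)` vertices
(`hasBColoring_of_card_lt`). There are at most `k` high vertices, so there must be many tight ones.
Discard those whose closed neighborhood meets that of the high vertices. Without the edges at high
vertices all degrees are below `k`, so balls of radius three have at most `k ^ 3` vertices, and `k`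
tight vertices with disjoint, mutually nonadjacent closed neighborhoods can be picked greedily. Each
of these neighborhoods has exactly `k` vertices and is colored with all `k` colors, the `i`-th
center getting color `i`. The high vertices get distinct colors, and all other vertices have degree
below `k` and are colored greedily (`hasBColoring_of_tight`).

To obtain an actual machine, every quantity is written as an arithmetic expression with bounded
sums. The compiler `Ex.compile` is proved correct and polynomial once, by induction on expressions
(`Ex.compile_runs`), so that for the kernelization only the values of expressions have to be
studied. -/

/-! ## Running times and arithmetic expressions -/

namespace RAM

/-- Started in `c`, the program `p` halts after at most `T` steps in a configuration with `Q`. -/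
def Runs (p : Program) (c : Config) (T : ℕ) (Q : Config → Prop) : Prop :=
  ∃ t d, Exec p c t d ∧ t ≤ T ∧ Q d

namespace Runs

variable {p q : Program} {c : Config} {T U : ℕ} {Q R : Config → Prop}

theorem mono (h : Runs p c T Q) (hT : T ≤ U) (hQ : ∀ d, Q d → R d) : Runs p c U R := by
  obtain ⟨t, d, h, ht, hd⟩ := h
  exact ⟨t, d, h, ht.trans hT, hQ d hd⟩

theorem seq (hp : Runs p c T Q) (hq : ∀ d, Q d → Runs q d U R) :
    Runs (Program.seq p q) c (T + U) R := by
  obtain ⟨t, d, h, ht, hd⟩ := hp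
  obtain ⟨u, e, h', hu, he⟩ := hq d hd
  exact ⟨t + u, e, Exec.seq h h', by omega, he⟩

theorem const {r n : ℕ} (h : Q (c.setReg r n)) : Runs (Program.const r n) c 1 Q :=
  ⟨1, _, Exec.const r n c, le_rfl, h⟩

theorem add {r s t : ℕ} (h : Q (c.setReg r (c.reg s + c.reg t))) :
    Runs (Program.add r s t) c 1 Q :=
  ⟨1, _, Exec.add r s t c, le_rfl, h⟩

theorem sub {r s t : ℕ} (h : Q (c.setReg r (c.reg s - c.reg t))) :
    Runs (Program.sub r s t) c 1 Q :=
  ⟨1, _, Exec.sub r s t c, le_rfl, h⟩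

theorem load {r s : ℕ} (h : Q (c.setReg r (c.mem (c.reg s)))) :
    Runs (Program.load r s) c 1 Q :=
  ⟨1, _, Exec.load r s c, le_rfl, h⟩

theorem store {r s : ℕ} (h : Q (c.setMem (c.reg r) (c.reg s))) :
    Runs (Program.store r s) c 1 Q :=
  ⟨1, _, Exec.store r s c, le_rfl, h⟩

theorem cond {r : ℕ} (hp : c.reg r ≠ 0 → Runs p c T Q) (hq : c.reg r = 0 → Runs q c T Q) :
    Runs (Program.cond r p q) c (T + 1) Q := by
  by_cases h : c.reg r = 0
  · obtain ⟨t, d, h', ht, hd⟩ := hq h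
    exact ⟨t + 1, d, Exec.cond_zero h h', by omega, hd⟩
  · obtain ⟨t, d, h', ht, hd⟩ := hp h
    exact ⟨t + 1, d, Exec.cond_pos h h', by omega, hd⟩

/-- A loop whose counter `r` is decreased by one in each round. -/
theorem countdown {r : ℕ} (n : ℕ) (I : ℕ → Config → Prop)
    (step : ∀ j < n, ∀ c, I j c → c.reg r = n - j →
      Runs p c T fun d => I (j + 1) d ∧ d.reg r = n - (j + 1))
    (h0 : I 0 c) (hr : c.reg r = n) :
    Runs (Program.loop r p) c (n * (T + 1) + 1) (I n) := by
  suffices H : ∀ k j c, j + k = n → I j c → c.reg r = n - j →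
      Runs (Program.loop r p) c (k * (T + 1) + 1) (I n) from H n 0 c (by simp) h0 (by simpa)
  intro k
  induction k with
  | zero =>
    intro j c hj hI hc
    obtain rfl : j = n := by omega
    exact ⟨1, c, Exec.loop_done (by simpa using hc), by omega, hI⟩
  | succ k ih =>
    intro j c hj hI hc
    obtain ⟨t, d, h, ht, hd, hdr⟩ := step j (by omega) c hI hc
    obtain ⟨u, e, h', hu, he⟩ := ih (j + 1) d (by omega) hd hdr
    refine ⟨t + u + 1, e, Exec.loop_step (by omega) h h', ?_, he⟩
    rw [Nat.succ_mul]
    omega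

end Runs

@[simp] theorem Config.setReg_reg (c : Config) (r v s : ℕ) :
    (c.setReg r v).reg s = if s = r then v else c.reg s := by
  simp [Config.setReg, Function.update_apply]

@[simp] theorem Config.setReg_mem (c : Config) (r v : ℕ) : (c.setReg r v).mem = c.mem := rfl

@[simp] theorem Config.setMem_reg (c : Config) (a v : ℕ) : (c.setMem a v).reg = c.reg := rfl

@[simp] theorem Config.setMem_mem (c : Config) (a v b : ℕ) :
    (c.setMem a v).mem b = if b = a then v else c.mem b := by
  simp [Config.setMem, Function.update_apply]

/-- `reg r := reg s`, for `s ≠ r`. -/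
def copy (r s : ℕ) : Program := Program.seq (Program.const r 0) (Program.add r r s)

theorem Runs.copy {r s : ℕ} {c : Config} {Q : Config → Prop} (hrs : s ≠ r)
    (h : Q (c.setReg r (c.reg s))) : Runs (copy r s) c 2 Q := by
  refine (Runs.seq (U := 1) (Q := fun d => d = c.setReg r 0) (Runs.const rfl) ?_).mono
    le_rfl fun d hd => hd
  rintro d rfl
  apply Runs.add
  convert h using 1
  simp [Config.setReg, hrs]

/-- `d` is `c` with a new value in register `r`; the registers above `r` are arbitrary. -/
structure Sets (r v : ℕ) (c d : Config) : Prop where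
  mem : d.mem = c.mem
  below : ∀ s < r, d.reg s = c.reg s
  val : d.reg r = v

/-! ### Expressions, their compilation and polynomial bounds -/

/-- Arithmetic expressions with named variables, access to a read-only memory, local definitions
and bounded sums. -/
inductive Ex : Type
  | var (x : ℕ) : Ex
  | const (n : ℕ) : Ex
  | add (a b : Ex) : Ex
  | sub (a b : Ex) : Ex
  | mul (a b : Ex) : Ex
  | load (a : Ex) : Ex
  | bind (x : ℕ) (a b : Ex) : Ex
  | sum (x : ℕ) (a b : Ex) : Ex

/-- The value of an expression. -/
def Ex.eval (m : ℕ → ℕ) : Ex → (ℕ → ℕ) → ℕ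
  | .var x, v => v x
  | .const n, _ => n
  | .add a b, v => a.eval m v + b.eval m v
  | .sub a b, v => a.eval m v - b.eval m v
  | .mul a b, v => a.eval m v * b.eval m v
  | .load a, v => m (a.eval m v)
  | .bind x a b, v => b.eval m (Function.update v x (a.eval m v))
  | .sum x a b, v => ∑ j ∈ Finset.range (a.eval m v), b.eval m (Function.update v x j)

/-- With the number of rounds in register `r`, add up the values that `p` computes in register
`r + 4` from the index in register `r + 2`, and put the sum into register `r`. -/
def sumLoop (r : ℕ) (p : Program) : Program :=
  .seq (.const (r + 1) 0) <| .seq (.const (r + 2) 0) <| .seq (.const (r + 3) 1) <|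
  .seq (.loop r (.seq p (.seq (.add (r + 1) (r + 1) (r + 4))
    (.seq (.add (r + 2) (r + 2) (r + 3)) (.sub r r (r + 3)))))) (copy r (r + 1))

/-- Counter, accumulator, index and the constant one sit in the registers `r` to `r + 3`, which `p`
leaves alone. A round costs at most `T + 3` steps and a test; the three initial constants, the last
test and the copy make up the `6`. -/
theorem sumLoop_runs {r : ℕ} {p : Program} {c : Config} {T : ℕ} (g : ℕ → ℕ)
    (hp : ∀ j < c.reg r, ∀ d : Config, d.mem = c.mem → (∀ s < r, d.reg s = c.reg s) →
      d.reg (r + 2) = j → Runs p d T (Sets (r + 4) (g j) d)) :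
    Runs (sumLoop r p) c (c.reg r * (T + 4) + 6)
      (Sets r (∑ j ∈ Finset.range (c.reg r), g j) c) := by
  have key : ∀ d : Config, d = ((c.setReg (r + 1) 0).setReg (r + 2) 0).setReg (r + 3) 1 →
      Runs (.loop r (.seq p (.seq (.add (r + 1) (r + 1) (r + 4))
        (.seq (.add (r + 2) (r + 2) (r + 3)) (.sub r r (r + 3)))))) d (c.reg r * (T + 4) + 1)
        fun e => e.mem = c.mem ∧ (∀ s < r, e.reg s = c.reg s) ∧
          e.reg (r + 1) = ∑ i ∈ Finset.range (c.reg r), g i ∧ e.reg (r + 2) = c.reg r ∧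
          e.reg (r + 3) = 1 := by
    rintro d rfl
    refine Runs.countdown (c.reg r) (fun j e => e.mem = c.mem ∧ (∀ s < r, e.reg s = c.reg s) ∧
      e.reg (r + 1) = ∑ i ∈ Finset.range j, g i ∧ e.reg (r + 2) = j ∧ e.reg (r + 3) = 1)
      ?_ ?_ ?_
    · rintro j hj e ⟨h1, h2, h3, h4, h5⟩ h6
      refine (Runs.seq (hp j hj e h1 h2 h4) (U := 3) ?_).mono le_rfl fun d hd => hd
      rintro d ⟨hd1, hd2, hd3⟩
      refine Runs.seq (T := 1) (U := 2) (Q := fun x => x = _) (Runs.add rfl) ?_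
      rintro _ rfl
      refine Runs.seq (T := 1) (U := 1) (Q := fun x => x = _) (Runs.add rfl) ?_
      rintro _ rfl
      refine Runs.sub ⟨⟨?_, ?_, ?_, ?_, ?_⟩, ?_⟩
      · simp [hd1, h1]
      · intro s hs
        have : s ≠ r := by omega
        have : s ≠ r + 1 := by omega
        have : s ≠ r + 2 := by omega
        simp [*, hd2 s (by omega)]
      · simp [hd2 (r + 1) (by omega), hd3, h3, Finset.sum_range_succ]
      · simp [hd2 (r + 2) (by omega), hd2 (r + 3) (by omega), h4, h5]
      · simp [hd2 (r + 3) (by omega), h5]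
      · simp [hd2 r (by omega), hd2 (r + 3) (by omega), h6, h5]
        omega
    · refine ⟨rfl, ?_, by simp, by simp, by simp⟩
      intro s hs
      have : s ≠ r + 1 := by omega
      have : s ≠ r + 2 := by omega
      have : s ≠ r + 3 := by omega
      simp [*]
    · simp
  refine (Runs.seq (T := 1) (Q := fun x => x = _) (Runs.const rfl) ?_).mono
    (T := 1 + (1 + (1 + (c.reg r * (T + 4) + 1 + 2)))) (by omega) fun d hd => hd
  rintro _ rfl
  refine Runs.seq (T := 1) (Q := fun x => x = _) (Runs.const rfl) ?_
  rintro _ rfl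
  refine Runs.seq (T := 1) (Q := fun x => x = _) (Runs.const rfl) ?_
  intro d hd
  refine Runs.seq (key d hd) ?_
  rintro e ⟨h1, h2, h3, h4, h5⟩
  refine Runs.copy (by omega) ⟨by simpa using h1, ?_, by simpa using h3⟩
  intro s hs
  have : s ≠ r := by omega
  simp [this, h2 s hs]

/-- A program that puts the value of an expression into register `r`, where the variable `x` is
stored in register `v x`, register `0` holds the length of the memory, and only the registers from
`r` on are changed. -/
def Ex.compile : Ex → (ℕ → ℕ) → ℕ → Program
  | .var x, v, r => copy r (v x)
  | .const n, _, r => .const r n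
  | .add a b, v, r => .seq (a.compile v r) (.seq (b.compile v (r + 1)) (.add r r (r + 1)))
  | .sub a b, v, r => .seq (a.compile v r) (.seq (b.compile v (r + 1)) (.sub r r (r + 1)))
  -- Multiplication is repeated addition: the second factor is recomputed in every round.
  | .mul a b, v, r => .seq (a.compile v r) (sumLoop r (b.compile v (r + 4)))
  -- Register `r + 1` receives length minus address, which is nonzero exactly for addresses inside
  -- the input. Beyond the input the cells may hold partial output, so the value there is set to
  -- zero.
  | .load a, v, r => .seq (a.compile v r)
      (.seq (.sub (r + 1) 0 r) (.cond (r + 1) (.load r r) (.const r 0)))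
  | .bind x a b, v, r => .seq (a.compile v r)
      (.seq (b.compile (Function.update v x r) (r + 1)) (copy r (r + 1)))
  | .sum x a b, v, r => .seq (a.compile v r)
      (sumLoop r (b.compile (Function.update v x (r + 2)) (r + 4)))

/-- An exponent that bounds the value of an expression and the running time of its program. -/
def Ex.exponent : Ex → ℕ
  | .var _ => 1
  | .const n => n + 1
  | .add a b => a.exponent + b.exponent + 2
  | .sub a b => a.exponent + b.exponent + 2
  | .mul a b => 2 * a.exponent + b.exponent + 8
  | .load a => a.exponent + 3
  | .bind _ a b => a.exponent + (a.exponent + 1) * b.exponent + 3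
  | .sum _ a b => 2 * a.exponent + (a.exponent + 1) * b.exponent + 8

/-- The configuration `c` stores the memory `m` of length `l` and the variables `e`, the variable
`x` in register `v x`. -/
structure Holds (m : ℕ → ℕ) (l : ℕ) (v e : ℕ → ℕ) (r : ℕ) (c : Config) : Prop where
  pos : 0 < r
  len : c.reg 0 = l
  mem : ∀ i < l, c.mem i = m i
  zero : ∀ i, l ≤ i → m i = 0
  lt : ∀ x, v x < r
  val : ∀ x, c.reg (v x) = e x

theorem Holds.of_agree {m : ℕ → ℕ} {l : ℕ} {v e : ℕ → ℕ} {r s : ℕ} {c d : Config}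
    (h : Holds m l v e r c) (hrs : r ≤ s) (hm : d.mem = c.mem)
    (hr : ∀ s < r, d.reg s = c.reg s) : Holds m l v e s d where
  pos := h.pos.trans_le hrs
  len := (hr 0 h.pos).trans h.len
  mem := fun i hi => by rw [hm, h.mem i hi]
  zero := h.zero
  lt := fun x => (h.lt x).trans_le hrs
  val := fun x => (hr _ (h.lt x)).trans (h.val x)

theorem Holds.update {m : ℕ → ℕ} {l : ℕ} {v e : ℕ → ℕ} {r s : ℕ} {c : Config}
    (h : Holds m l v e r c) (hs : s < r) (x : ℕ) {j : ℕ} (hj : c.reg s = j) :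
    Holds m l (Function.update v x s) (Function.update e x j) r c where
  pos := h.pos
  len := h.len
  mem := h.mem
  zero := h.zero
  lt := fun y => by
    by_cases hy : y = x
    · simpa [hy] using hs
    · simpa [hy] using h.lt y
  val := fun y => by
    by_cases hy : y = x
    · simpa [hy] using hj
    · simpa [hy] using h.val y

theorem add_le_pow {N x y a b : ℕ} (hN : 2 ≤ N) (hx : x ≤ N ^ a) (hy : y ≤ N ^ b) :
    x + y ≤ N ^ (a + b + 1) := by
  have h1 : N ^ a ≤ N ^ (a + b) := Nat.pow_le_pow_right (by omega) (by omega)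
  have h2 : N ^ b ≤ N ^ (a + b) := Nat.pow_le_pow_right (by omega) (by omega)
  calc x + y ≤ N ^ (a + b) * 2 := by omega
    _ ≤ N ^ (a + b) * N := Nat.mul_le_mul_left _ hN
    _ = _ := (pow_succ _ _).symm

theorem update_le {e : ℕ → ℕ} {N M : ℕ} (he : ∀ x, e x ≤ N) (hNM : N ≤ M) (x : ℕ) {j : ℕ}
    (hj : j ≤ M) (y : ℕ) : Function.update e x j y ≤ M := by
  by_cases hy : y = x
  · simpa [hy] using hj
  · simpa [hy] using (he y).trans hNM

/-- The base `N` is universally quantified because a variable bound by `bind` or `sum` can be as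
large as a power of `N`. The induction hypothesis for the body is applied with base `N ^ (a.exponent
+ 1)`, which is why exponents multiply there. -/
theorem Ex.eval_le (m : ℕ → ℕ) (a : Ex) : ∀ (e : ℕ → ℕ) (N : ℕ), 2 ≤ N → (∀ i, m i ≤ N) →
    (∀ x, e x ≤ N) → a.eval m e ≤ N ^ a.exponent := by
  induction a with
  | var x => intro e N hN hm he; simpa [eval, exponent] using he x
  | const n =>
    intro e N hN hm he
    have := (Nat.lt_pow_self (n := n) (show 1 < N by omega)).le
    exact this.trans (Nat.pow_le_pow_right (by omega) (Nat.le_succ n))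
  | add a b iha ihb =>
    intro e N hN hm he
    exact (add_le_pow hN (iha e N hN hm he) (ihb e N hN hm he)).trans
      (Nat.pow_le_pow_right (by omega) (by simp [exponent]))
  | sub a b iha ihb =>
    intro e N hN hm he
    exact (Nat.sub_le _ _).trans ((iha e N hN hm he).trans
      (Nat.pow_le_pow_right (by omega) (by simp only [exponent]; omega)))
  | mul a b iha ihb =>
    intro e N hN hm he
    refine (Nat.mul_le_mul (iha e N hN hm he) (ihb e N hN hm he)).trans ?_
    rw [← pow_add]
    exact Nat.pow_le_pow_right (by omega) (by simp only [exponent]; omega)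
  | load a iha =>
    intro e N hN hm he
    exact (hm _).trans (Nat.le_self_pow (by simp [exponent]) N)
  | bind x a b iha ihb =>
    intro e N hN hm he
    have hNM : N ≤ N ^ (a.exponent + 1) := Nat.le_self_pow (by omega) N
    refine (ihb (Function.update e x (a.eval m e)) (N ^ (a.exponent + 1)) (hN.trans hNM)
      (fun i => (hm i).trans hNM) (update_le he hNM x ((iha e N hN hm he).trans
      (Nat.pow_le_pow_right (by omega) (by omega))))).trans ?_
    rw [← pow_mul]
    exact Nat.pow_le_pow_right (by omega) (by simp only [exponent]; omega)
  | sum x a b iha ihb =>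
    intro e N hN hm he
    have hNM : N ≤ N ^ (a.exponent + 1) := Nat.le_self_pow (by omega) N
    have ha := iha e N hN hm he
    have hb : ∀ j ∈ Finset.range (a.eval m e), b.eval m (Function.update e x j) ≤
        N ^ ((a.exponent + 1) * b.exponent) := by
      intro j hj
      rw [pow_mul]
      exact ihb _ _ (hN.trans hNM) (fun i => (hm i).trans hNM)
        (update_le he hNM x ((Finset.mem_range.1 hj).le.trans (ha.trans
        (Nat.pow_le_pow_right (by omega) (by omega)))))
    refine (Finset.sum_le_card_nsmul _ _ _ hb).trans ?_
    rw [Finset.card_range, smul_eq_mul]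
    refine (Nat.mul_le_mul_right _ ha).trans ?_
    rw [← pow_add]
    exact Nat.pow_le_pow_right (by omega) (by simp only [exponent]; omega)

/-- The base changes under binders as in `eval_le`, and that lemma also bounds the number of rounds
of each loop. -/
theorem Ex.compile_runs (m : ℕ → ℕ) (l : ℕ) (a : Ex) : ∀ (v e : ℕ → ℕ) (r N : ℕ) (c : Config),
    2 ≤ N → (∀ i, m i ≤ N) → (∀ x, e x ≤ N) → Holds m l v e r c →
    Runs (a.compile v r) c (N ^ a.exponent) (Sets r (a.eval m e) c) := by
  induction a with
  | var x =>
    intro v e r N c hN hm he h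
    refine (Runs.copy (h.lt x).ne ⟨rfl, fun s hs => ?_, ?_⟩).mono
      (hN.trans (by simp [exponent])) fun d hd => hd
    · simp [hs.ne]
    · simp [h.val, eval]
  | const n =>
    intro v e r N c hN hm he h
    refine (Runs.const ⟨rfl, fun s hs => ?_, ?_⟩).mono
      (Nat.one_le_pow _ _ (by omega)) fun d hd => hd
    · simp [hs.ne]
    · simp [eval]
  | add a b iha ihb =>
    intro v e r N c hN hm he h
    have hT : N ^ a.exponent + (N ^ b.exponent + 1) ≤ N ^ (exponent (.add a b)) :=
      (add_le_pow hN le_rfl (add_le_pow (b := 0) hN le_rfl le_rfl)).trans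
        (Nat.pow_le_pow_right (by omega) (by simp only [exponent]; omega))
    refine (Runs.seq (iha v e r N c hN hm he h) (R := Sets r (eval m (.add a b) e) c)
      fun d hd => ?_).mono hT fun d hd => hd
    refine Runs.seq (ihb v e (r + 1) N d hN hm he (h.of_agree (by omega) hd.mem hd.below))
      fun d' hd' => ?_
    refine Runs.add ⟨by simp [hd'.mem, hd.mem], fun s hs => ?_, ?_⟩
    · simp [hs.ne, hd'.below s (by omega), hd.below s hs]
    · simp [hd'.below r (by omega), hd.val, hd'.val, eval]
  | sub a b iha ihb =>
    intro v e r N c hN hm he h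
    have hT : N ^ a.exponent + (N ^ b.exponent + 1) ≤ N ^ (exponent (.sub a b)) :=
      (add_le_pow hN le_rfl (add_le_pow (b := 0) hN le_rfl le_rfl)).trans
        (Nat.pow_le_pow_right (by omega) (by simp only [exponent]; omega))
    refine (Runs.seq (iha v e r N c hN hm he h) (R := Sets r (eval m (.sub a b) e) c)
      fun d hd => ?_).mono hT fun d hd => hd
    refine Runs.seq (ihb v e (r + 1) N d hN hm he (h.of_agree (by omega) hd.mem hd.below))
      fun d' hd' => ?_
    refine Runs.sub ⟨by simp [hd'.mem, hd.mem], fun s hs => ?_, ?_⟩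
    · simp [hs.ne, hd'.below s (by omega), hd.below s hs]
    · simp [hd'.below r (by omega), hd.val, hd'.val, eval]
  | mul a b iha ihb =>
    intro v e r N c hN hm he h
    have ha := eval_le m a e N hN hm he
    have hT : N ^ a.exponent + (N ^ a.exponent * (N ^ b.exponent + 4) + 6) ≤
        N ^ (exponent (.mul a b)) := by
      have h4 : 4 ≤ N ^ 2 := Nat.pow_le_pow_left hN 2
      have h6 : 6 ≤ N ^ 3 := le_trans (by norm_num) (Nat.pow_le_pow_left hN 3)
      have h1 := Nat.mul_le_mul_left (N ^ a.exponent)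
        (add_le_pow hN (le_refl (N ^ b.exponent)) h4)
      rw [← pow_add] at h1
      refine (add_le_pow hN le_rfl (add_le_pow hN h1 h6)).trans ?_
      exact Nat.pow_le_pow_right (by omega) (by simp only [exponent]; omega)
    refine (Runs.seq (iha v e r N c hN hm he h) (R := Sets r (eval m (.mul a b) e) c)
      fun d hd => ?_).mono hT fun d hd => hd
    refine (sumLoop_runs (fun _ => b.eval m e) fun j hj d' h1 h2 h3 =>
      ihb v e (r + 4) N d' hN hm he ?_).mono ?_ fun d' hd' => ⟨?_, ?_, ?_⟩
    · exact h.of_agree (by omega) (h1.trans hd.mem) fun s hs => (h2 s hs).trans (hd.below s hs)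
    · rw [hd.val]
      gcongr
    · exact hd'.mem.trans hd.mem
    · exact fun s hs => (hd'.below s hs).trans (hd.below s hs)
    · rw [hd'.val, hd.val]
      simp [eval]
  | load a iha =>
    intro v e r N c hN hm he h
    have hT : N ^ a.exponent + (1 + (1 + 1)) ≤ N ^ (exponent (.load a)) :=
      add_le_pow (b := 2) hN le_rfl (le_trans (by norm_num) (Nat.pow_le_pow_left hN 2))
    refine (Runs.seq (iha v e r N c hN hm he h) (R := Sets r (eval m (.load a) e) c)
      fun d hd => ?_).mono hT fun d hd => hd
    have hl : d.reg 0 = l := (hd.below 0 h.pos).trans h.len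
    have hr : r ≠ 0 := h.pos.ne'
    refine Runs.seq (T := 1) (Q := fun x => x = _) (Runs.sub rfl) ?_
    rintro _ rfl
    refine Runs.cond (fun h0 => Runs.load ⟨hd.mem, fun s hs => ?_, ?_⟩)
      fun h0 => Runs.const ⟨hd.mem, fun s hs => ?_, ?_⟩
    · simp [hs.ne, (show s ≠ r + 1 by omega), hd.below s hs]
    · simp only [Config.setReg_reg, if_true, hl, hd.val] at h0
      simp [hd.val, hd.mem, eval]
      exact h.mem _ (by omega)
    · simp [hs.ne, (show s ≠ r + 1 by omega), hd.below s hs]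
    · simp only [Config.setReg_reg, if_true, hl, hd.val] at h0
      simp [eval]
      exact (h.zero _ (by omega)).symm
  | bind x a b iha ihb =>
    intro v e r N c hN hm he h
    have ha := eval_le m a e N hN hm he
    have hNM : N ≤ N ^ (a.exponent + 1) := Nat.le_self_pow (by omega) N
    have hT : N ^ a.exponent + ((N ^ (a.exponent + 1)) ^ b.exponent + 2) ≤
        N ^ (exponent (.bind x a b)) := by
      rw [← pow_mul]
      exact (add_le_pow hN le_rfl (add_le_pow (b := 1) hN le_rfl (by simpa using hN))).trans
        (Nat.pow_le_pow_right (by omega) (by simp only [exponent]; omega))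
    refine (Runs.seq (iha v e r N c hN hm he h) (R := Sets r (eval m (.bind x a b) e) c)
      fun d hd => ?_).mono hT fun d hd => hd
    refine Runs.seq (ihb _ (Function.update e x (a.eval m e)) (r + 1) (N ^ (a.exponent + 1)) d
      (hN.trans hNM) (fun i => (hm i).trans hNM) (update_le he hNM x (ha.trans
      (Nat.pow_le_pow_right (by omega) (by omega)))) ((h.of_agree (s := r + 1) (by omega) hd.mem
      hd.below).update (by omega) x hd.val)) fun d' hd' => ?_
    refine Runs.copy (by omega) ⟨by simp [hd'.mem, hd.mem], fun s hs => ?_, ?_⟩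
    · simp [hs.ne, hd'.below s (by omega), hd.below s hs]
    · simp [hd'.val, eval]
  | sum x a b iha ihb =>
    intro v e r N c hN hm he h
    have ha := eval_le m a e N hN hm he
    have hNM : N ≤ N ^ (a.exponent + 1) := Nat.le_self_pow (by omega) N
    have hT : N ^ a.exponent + (N ^ a.exponent * ((N ^ (a.exponent + 1)) ^ b.exponent + 4) + 6) ≤
        N ^ (exponent (.sum x a b)) := by
      have h4 : 4 ≤ N ^ 2 := Nat.pow_le_pow_left hN 2
      have h6 : 6 ≤ N ^ 3 := le_trans (by norm_num) (Nat.pow_le_pow_left hN 3)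
      rw [← pow_mul]
      have h1 := Nat.mul_le_mul_left (N ^ a.exponent)
        (add_le_pow hN (le_refl (N ^ ((a.exponent + 1) * b.exponent))) h4)
      rw [← pow_add] at h1
      refine (add_le_pow hN le_rfl (add_le_pow hN h1 h6)).trans ?_
      exact Nat.pow_le_pow_right (by omega) (by simp only [exponent]; omega)
    refine (Runs.seq (iha v e r N c hN hm he h) (R := Sets r (eval m (.sum x a b) e) c)
      fun d hd => ?_).mono hT fun d hd => hd
    refine (sumLoop_runs (fun j => b.eval m (Function.update e x j)) fun j hj d' h1 h2 h3 =>
      ihb _ _ (r + 4) (N ^ (a.exponent + 1)) d' (hN.trans hNM) (fun i => (hm i).trans hNM)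
      (update_le he hNM x ?_) (Holds.update ?_ (by omega) x h3)).mono ?_
      fun d' hd' => ⟨?_, ?_, ?_⟩
    · rw [hd.val] at hj
      exact hj.le.trans (ha.trans (Nat.pow_le_pow_right (by omega) (by omega)))
    · exact h.of_agree (by omega) (h1.trans hd.mem) fun s hs => (h2 s hs).trans (hd.below s hs)
    · rw [hd.val]
      gcongr
    · exact hd'.mem.trans hd.mem
    · exact fun s hs => (hd'.below s hs).trans (hd.below s hs)
    · rw [hd'.val, hd.val]
      simp [eval]

end RAM

/-! ### Programs that write out an answer -/

namespace RAM

/-- The registers of the input variables: `0` is the length, `1` is the parameter. -/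
def inputReg (x : ℕ) : ℕ := if x = 1 then 1 else 0

/-- The values of the input variables. -/
def inputVal (l k x : ℕ) : ℕ := if x = 1 then k else l

/-- Write the values of `val`, for the variable `2` from `0` to `len - 1`, behind the memory that is
in use, copy them to the beginning of the memory, and answer as `code` says. -/
def answerProgram (code len val : Ex) : Program :=
  .seq (code.compile inputReg 2) <| .seq (len.compile inputReg 3) <|
  .seq (.add 4 0 3) <| .seq (.const 5 0) <| .seq (.const 6 1) <| .seq (.add 7 5 3) <|
  .seq (.loop 7 (.seq (val.compile (Function.update inputReg 2 5) 8) <|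
    .seq (.add 9 4 5) <| .seq (.store 9 8) <| .seq (.add 5 5 6) <| .sub 7 7 6)) <|
  .seq (.const 5 0) <| .seq (.add 7 5 3) <|
  .seq (.loop 7 (.seq (.add 9 4 5) <| .seq (.load 8 9) <| .seq (.store 5 8) <|
    .seq (.add 5 5 6) <| .sub 7 7 6)) <|
  .seq (.const 5 0) <| .seq (.add 0 5 2) <| .seq (.add 2 5 1) <| .add 1 5 3

section Steps

variable {q : Program} {c : Config} {U : ℕ} {R : Config → Prop}

theorem Runs.const_seq {r n : ℕ} (h : Runs q (c.setReg r n) U R) :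
    Runs (.seq (.const r n) q) c (1 + U) R :=
  Runs.seq (Q := fun d => d = c.setReg r n) (Runs.const rfl) (by rintro _ rfl; exact h)

theorem Runs.add_seq {r s t : ℕ} (h : Runs q (c.setReg r (c.reg s + c.reg t)) U R) :
    Runs (.seq (.add r s t) q) c (1 + U) R :=
  Runs.seq (Q := fun d => d = _) (Runs.add rfl) (by rintro _ rfl; exact h)

theorem Runs.load_seq {r s : ℕ} (h : Runs q (c.setReg r (c.mem (c.reg s))) U R) :
    Runs (.seq (.load r s) q) c (1 + U) R :=
  Runs.seq (Q := fun d => d = _) (Runs.load rfl) (by rintro _ rfl; exact h)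

theorem Runs.store_seq {r s : ℕ} (h : Runs q (c.setMem (c.reg r) (c.reg s)) U R) :
    Runs (.seq (.store r s) q) c (1 + U) R :=
  Runs.seq (Q := fun d => d = _) (Runs.store rfl) (by rintro _ rfl; exact h)

end Steps

/-- The buffer starts at `l + n`. Being at least `l`, this spares the input, from which later
entries are still computed; being at least `n`, it keeps the sources of the later copying apart from
its targets. -/
theorem fill_runs {val : Ex} {m : ℕ → ℕ} {l k N n a : ℕ} {c : Config} (hN : 2 ≤ N)
    (hm : ∀ i, m i ≤ N) (hl : l ≤ N) (hk : k ≤ N) (hn : n ≤ N)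
    (hz : ∀ i, l ≤ i → m i = 0) (hmem : ∀ i < l, c.mem i = m i)
    (h0 : c.reg 0 = l) (h1 : c.reg 1 = k) (h2 : c.reg 2 = a) (h3 : c.reg 3 = n)
    (h4 : c.reg 4 = l + n) (h5 : c.reg 5 = 0) (h6 : c.reg 6 = 1) (h7 : c.reg 7 = n) :
    Runs (.loop 7 (.seq (val.compile (Function.update inputReg 2 5) 8) <|
      .seq (.add 9 4 5) <| .seq (.store 9 8) <| .seq (.add 5 5 6) <| .sub 7 7 6)) c
      (n * (N ^ val.exponent + 4 + 1) + 1) fun d => d.reg 1 = k ∧ d.reg 2 = a ∧ d.reg 3 = n ∧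
        d.reg 4 = l + n ∧ d.reg 6 = 1 ∧
        ∀ i < n, d.mem (l + n + i) = val.eval m (Function.update (inputVal l k) 2 i) := by
  refine (Runs.countdown n (fun j d => d.reg 0 = l ∧ d.reg 1 = k ∧ d.reg 2 = a ∧ d.reg 3 = n ∧
    d.reg 4 = l + n ∧ d.reg 5 = j ∧ d.reg 6 = 1 ∧ (∀ i < l, d.mem i = m i) ∧
    ∀ i < j, d.mem (l + n + i) = val.eval m (Function.update (inputVal l k) 2 i))
    ?_ ⟨h0, h1, h2, h3, h4, h5, h6, hmem, by simp⟩ h7).mono le_rfl ?_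
  · rintro j hj d ⟨g0, g1, g2, g3, g4, g5, g6, gm, gv⟩ g7
    refine Runs.seq (U := 1 + (1 + (1 + 1)))
      (Ex.compile_runs m l val _ (Function.update (inputVal l k) 2 j) 8 N d hN hm ?_
      ⟨by omega, g0, gm, hz, ?_, ?_⟩) ?_
    · exact update_le (N := N) (fun x => by unfold inputVal; split_ifs <;> assumption) le_rfl _
        (by omega)
    · intro x
      simp only [Function.update_apply, inputReg]
      split_ifs <;> omega
    · intro x
      simp only [Function.update_apply, inputReg, inputVal]
      split_ifs <;> assumption
    · intro e he
      have b := he.below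
      have e0 := (b 0 (by omega)).trans g0
      have e1 := (b 1 (by omega)).trans g1
      have e2 := (b 2 (by omega)).trans g2
      have e3 := (b 3 (by omega)).trans g3
      have e4 := (b 4 (by omega)).trans g4
      have e5 := (b 5 (by omega)).trans g5
      have e6 := (b 6 (by omega)).trans g6
      have e7 := (b 7 (by omega)).trans g7
      refine Runs.add_seq (Runs.store_seq (Runs.add_seq (Runs.sub
        ⟨⟨by simp [e0], by simp [e1], by simp [e2], by simp [e3], by simp [e4],
          by simp [e5, e6], by simp [e6], ?_, ?_⟩, by simp [e6, e7]; omega⟩)))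
      · intro i hi
        simp [e4, e5, (show i ≠ l + n + j by omega), he.mem, gm i hi]
      · intro i hi
        simp only [Config.setReg_mem, Config.setMem_mem, Config.setReg_reg]
        rcases Nat.lt_succ_iff_lt_or_eq.1 hi with hi | rfl
        · simp [e4, e5, hi.ne, he.mem, gv i hi]
        · simp [e4, e5, he.val]
  · rintro d ⟨g0, g1, g2, g3, g4, g5, g6, gm, gv⟩
    exact ⟨g1, g2, g3, g4, g6, gv⟩

theorem copyBack_runs {w : ℕ → ℕ} {s k n a : ℕ} {c : Config} (hs : n ≤ s)
    (hw : ∀ i < n, c.mem (s + i) = w i) (h1 : c.reg 1 = k) (h2 : c.reg 2 = a) (h3 : c.reg 3 = n)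
    (h4 : c.reg 4 = s) (h5 : c.reg 5 = 0) (h6 : c.reg 6 = 1) (h7 : c.reg 7 = n) :
    Runs (.loop 7 (.seq (.add 9 4 5) <| .seq (.load 8 9) <| .seq (.store 5 8) <|
      .seq (.add 5 5 6) <| .sub 7 7 6)) c (n * (5 + 1) + 1) fun d =>
        d.reg 1 = k ∧ d.reg 2 = a ∧ d.reg 3 = n ∧ ∀ i < n, d.mem i = w i := by
  refine (Runs.countdown n (fun j d => d.reg 1 = k ∧ d.reg 2 = a ∧ d.reg 3 = n ∧
    d.reg 4 = s ∧ d.reg 5 = j ∧ d.reg 6 = 1 ∧ (∀ i < n, d.mem (s + i) = w i) ∧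
    ∀ i < j, d.mem i = w i) ?_ ⟨h1, h2, h3, h4, h5, h6, hw, by simp⟩ h7).mono le_rfl ?_
  · rintro j hj d ⟨g1, g2, g3, g4, g5, g6, gm, gv⟩ g7
    refine (Runs.add_seq (Runs.load_seq (Runs.store_seq (Runs.add_seq (Runs.sub
      ⟨⟨by simp [g1], by simp [g2], by simp [g3], by simp [g4],
        by simp [g5, g6], by simp [g6], ?_, ?_⟩, by simp [g6, g7]; omega⟩))))).mono
        le_rfl fun d hd => hd
    · intro i hi
      simp [g5, (show s + i ≠ j by omega), gm i hi]
    · intro i hi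
      simp only [Config.setReg_mem, Config.setMem_mem, Config.setReg_reg]
      rcases Nat.lt_succ_iff_lt_or_eq.1 hi with hi | rfl
      · simp [g5, hi.ne, gv i hi]
      · simp [g4, g5, gm i hj]
  · rintro d ⟨g1, g2, g3, g4, g5, g6, gm, gv⟩
    exact ⟨g1, g2, g3, gv⟩

end RAM

namespace Parameterized

open RAM

/-- The input as a function. -/
def bits (x : List Bool) (i : ℕ) : ℕ := if x.getD i false = true then 1 else 0

/-- The answer of `answerProgram code len val`. -/
def answerOf (code len val : Ex) (x : List Bool) (k : ℕ) : Outcome :=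
  let e := inputVal x.length k
  if code.eval (bits x) e = 0 then Outcome.reject
  else if code.eval (bits x) e = 1 then Outcome.accept
  else Outcome.reduced ((List.range (len.eval (bits x) e)).map fun i =>
    decide (val.eval (bits x) (Function.update e 2 i) ≠ 0)) k

theorem answerProgram_answers (code len val : Ex) : ∃ A : ℕ, ∀ (x : List Bool) (k : ℕ), ∃ t : ℕ,
    Answers (answerProgram code len val) x k t (answerOf code len val x k) ∧
      t + (answerOf code len val x k).size ≤ (x.length + k + 2) ^ A := by
  set p := code.exponent with hp
  set q := len.exponent with hq
  set r := val.exponent with hr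
  refine ⟨p + q + (q + 1) * r + 2 * q + 30, fun x k => ?_⟩
  set N := x.length + k + 2 with hN
  set l := x.length with hl
  have hN2 : 2 ≤ N := by omega
  set m := bits x with hm
  have hm1 : ∀ i, m i ≤ 1 := fun i => by simp only [hm, bits]; split_ifs <;> omega
  have hmN : ∀ i, m i ≤ N := fun i => (hm1 i).trans (by omega)
  have hz : ∀ i, l ≤ i → m i = 0 := fun i hi => by
    simp [hm, bits, List.getElem?_eq_none hi]
  set e := inputVal l k with he
  have heN : ∀ y, e y ≤ N := fun y => by simp only [he, inputVal]; split_ifs <;> omega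
  set n := len.eval m e with hn
  have hnq : n ≤ N ^ q := Ex.eval_le m len e N hN2 hmN heN
  -- The index of an output entry runs up to `n ≤ N ^ q`, so the entries are computed with the
  -- larger base `M`.
  set M := N ^ (q + 1) with hM
  have hNM : N ≤ M := Nat.le_self_pow (by omega) N
  have hqM : N ^ q ≤ M := Nat.pow_le_pow_right (by omega) (by omega)
  set c := inputConfig x k with hc
  have hH : Holds m l inputReg e 2 c := by
    refine ⟨by omega, rfl, fun i hi => rfl, hz, fun y => ?_, fun y => ?_⟩
    · unfold inputReg; split_ifs <;> omega
    · simp only [inputReg, he, inputVal, hc, inputConfig]; split_ifs <;> simp_all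
  have run : Runs (answerProgram code len val) c
      (N ^ p + (N ^ q + (1 + (1 + (1 + (1 + ((n * (M ^ r + 4 + 1) + 1) + (1 + (1 +
      ((n * (5 + 1) + 1) + (1 + (1 + (1 + 1))))))))))))) fun d => d.reg 0 = code.eval m e ∧
        d.reg 1 = n ∧ d.reg 2 = k ∧ ∀ i < n, d.mem i = val.eval m (Function.update e 2 i) := by
    refine Runs.seq (Ex.compile_runs m l code _ e 2 N c hN2 hmN heN hH) fun d hd => ?_
    have hH' := hH.of_agree (s := 3) (by omega) hd.mem hd.below
    refine Runs.seq (Ex.compile_runs m l len _ e 3 N d hN2 hmN heN hH') fun f hf => ?_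
    have f0 : f.reg 0 = l := (hf.below 0 (by omega)).trans (hd.below 0 (by omega))
    have f1 : f.reg 1 = k := (hf.below 1 (by omega)).trans (hd.below 1 (by omega))
    have f2 : f.reg 2 = code.eval m e := (hf.below 2 (by omega)).trans hd.val
    have f3 : f.reg 3 = n := hf.val
    refine Runs.add_seq (Runs.const_seq (Runs.const_seq (Runs.add_seq ?_)))
    refine Runs.seq (fill_runs (m := m) (l := l) (k := k) (n := n) (a := code.eval m e) (N := M)
      (hN2.trans hNM) (fun i => (hmN i).trans hNM) (by omega) (by omega) (hnq.trans hqM) hz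
      (fun i hi => by simp [hf.mem, hd.mem]; rfl)
      (by simp [f0]) (by simp [f1]) (by simp [f2]) (by simp [f3]) (by simp [f0, f3]) (by simp)
      (by simp) (by simp [f3])) ?_
    rintro g ⟨g1, g2, g3, g4, g6, gv⟩
    refine Runs.const_seq (Runs.add_seq ?_)
    refine Runs.seq (copyBack_runs (s := l + n) (k := k) (n := n) (a := code.eval m e)
      (by omega) gv (by simp [g1]) (by simp [g2]) (by simp [g3]) (by simp [g4]) (by simp)
      (by simp [g6]) (by simp [g3])) ?_
    rintro h ⟨h1, h2, h3, hv⟩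
    exact Runs.const_seq (Runs.add_seq (Runs.add_seq (Runs.add
      ⟨by simp [h2], by simp [h3], by simp [h1], hv⟩)))
  obtain ⟨t, d, hd, ht, d0, d1, d2, dm⟩ := run
  have hans : outcomeOf d = answerOf code len val x k := by
    simp only [outcomeOf, answerOf, d0, d1, d2]
    refine if_congr Iff.rfl rfl (if_congr Iff.rfl rfl ?_)
    refine congrArg (fun y => Outcome.reduced y k) (List.map_congr_left fun i hi => ?_)
    rw [dm i (by simpa using hi)]
  refine ⟨t, ⟨d, hd, hans⟩, ?_⟩
  have hsize : (answerOf code len val x k).size ≤ n + N := by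
    simp only [answerOf]
    split_ifs
    · simp only [Outcome.size]; omega
    · simp only [Outcome.size]; omega
    · simp only [Outcome.size, List.length_map, List.length_range]
      have : n + k ≤ n + N := by omega
      exact this
  have h1 : n * (M ^ r + 5) ≤ N ^ (q + ((q + 1) * r + 3 + 1)) := by
    rw [pow_add N q]
    refine Nat.mul_le_mul hnq (add_le_pow hN2 ?_ ?_)
    · rw [hM, ← pow_mul]
    · exact le_trans (by norm_num) (Nat.pow_le_pow_left hN2 3)
  have h2 : n * 7 ≤ N ^ (q + 3) := by
    rw [pow_add]
    exact Nat.mul_le_mul hnq (le_trans (by norm_num) (Nat.pow_le_pow_left hN2 3))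
  have h3 : N + 12 ≤ N ^ (1 + 4 + 1) :=
    add_le_pow hN2 (by simp) (le_trans (by norm_num) (Nat.pow_le_pow_left hN2 4))
  have h4 : t + (answerOf code len val x k).size ≤
      N ^ p + (N ^ q + (n * (M ^ r + 5) + (n * 7 + (N + 12)))) := by
    have : n * (M ^ r + 4 + 1) = n * (M ^ r + 5) := rfl
    omega
  refine h4.trans ((add_le_pow hN2 le_rfl (add_le_pow hN2 le_rfl (add_le_pow hN2 h1
    (add_le_pow hN2 h2 h3)))).trans (Nat.pow_le_pow_right (by omega) ?_))
  omega

theorem answerProgram_poly (code len val : Ex) :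
    RunsInPolyTime (answerProgram code len val) := by
  obtain ⟨A, hA⟩ := answerProgram_answers code len val
  -- One number must serve as factor and as exponent: `2 ^ A` is the factor lost in passing to
  -- `x.length + k + 1`, and `A ≤ 2 ^ A`.
  refine ⟨2 ^ A, fun x k => ?_⟩
  obtain ⟨t, ht, h⟩ := hA x k
  refine ⟨t, _, ht, h.trans ?_⟩
  calc (x.length + k + 2) ^ A ≤ (2 * (x.length + k + 1)) ^ A := Nat.pow_le_pow_left (by omega) A
    _ = 2 ^ A * (x.length + k + 1) ^ A := mul_pow _ _ _
    _ ≤ _ := Nat.mul_le_mul_left _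
      (Nat.pow_le_pow_right (by omega) (Nat.lt_pow_self (by norm_num)).le)

/-- Execution is deterministic, so the run constructed above is the only one; correctness has to be
shown for every run. -/
theorem eq_answerOf {code len val : Ex} {x : List Bool} {k t : ℕ} {o : Outcome}
    (h : Answers (answerProgram code len val) x k t o) : o = answerOf code len val x k := by
  obtain ⟨A, hA⟩ := answerProgram_answers code len val
  obtain ⟨u, ⟨d', h', hd'⟩, -⟩ := hA x k
  obtain ⟨d, h, hd⟩ := h
  rw [← hd, ← hd', (h.deterministic h').2]

end Parameterized

/-! ## b-colorings with m(G) colors -/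

namespace SimpleGraph

open Classical Finset

variable {V : Type*} [Fintype V] (G : SimpleGraph V)

/-- The closed neighborhood. -/
noncomputable def closedNbhd (v : V) : Finset V := insert v (G.neighborFinset v)

/-- The union of the closed neighborhoods of the vertices in `S`. -/
noncomputable def closedNbhdOf (S : Finset V) : Finset V := S.biUnion G.closedNbhd

variable {G}

theorem mem_closedNbhd {v w : V} : w ∈ G.closedNbhd v ↔ w = v ∨ G.Adj v w := by
  simp [closedNbhd]

theorem mem_closedNbhdOf {S : Finset V} {w : V} :
    w ∈ G.closedNbhdOf S ↔ ∃ v ∈ S, w = v ∨ G.Adj v w := by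
  simp [closedNbhdOf, mem_closedNbhd]

theorem card_closedNbhd (v : V) : (G.closedNbhd v).card = G.degree v + 1 := by
  rw [closedNbhd, card_insert_of_notMem (by simp), card_neighborFinset_eq_degree]

theorem card_closedNbhdOf_le {S : Finset V} {b : ℕ} (h : ∀ v ∈ S, G.degree v + 1 ≤ b) :
    (G.closedNbhdOf S).card ≤ S.card * b :=
  card_biUnion_le_card_mul _ _ _ fun v hv => (card_closedNbhd v).trans_le (h v hv)

theorem le_mDegree {i : ℕ} (h : i ≤ G.numDegGePred i) : i ≤ G.mDegree :=
  G.mDegree_isGreatest.2 h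

theorem mDegree_le_numDegGePred : G.mDegree ≤ G.numDegGePred G.mDegree :=
  G.mDegree_isGreatest.1

theorem numDegGePred_antitone : Antitone G.numDegGePred := fun i j hij => by
  unfold numDegGePred
  exact card_le_card fun v hv => by simp at hv ⊢; omega

theorem degree_le_maxDeg (v : V) : G.degree v ≤ G.maxDeg := by
  unfold maxDeg
  convert G.degree_le_maxDegree v

theorem exists_degree_eq_maxDeg [Nonempty V] : ∃ v, G.degree v = G.maxDeg := by
  obtain ⟨v, hv⟩ := G.exists_maximal_degree_vertex
  exact ⟨v, hv.symm⟩

theorem mDegree_le_card : G.mDegree ≤ Fintype.card V :=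
  mDegree_le_numDegGePred.trans (card_le_univ _)

theorem mDegree_pos [Nonempty V] : 0 < G.mDegree :=
  le_mDegree (i := 1) (by
    simp only [numDegGePred, Nat.le_add_left, filter_true]
    exact Fintype.card_pos)

theorem mDegree_le_maxDeg_succ : G.mDegree ≤ G.maxDeg + 1 := by
  rcases Nat.eq_zero_or_pos G.mDegree with h | h
  · omega
  · have := h.trans_le (mDegree_le_numDegGePred (G := G))
    obtain ⟨v, hv⟩ := card_pos.1 this
    have h1 : G.mDegree ≤ G.degree v + 1 := by simpa using hv
    exact h1.trans (Nat.succ_le_succ (degree_le_maxDeg v))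

variable (G) in
/-- The vertices of degree at least `m(G) - 1`. -/
noncomputable def dense : Finset V := univ.filter fun v => G.mDegree ≤ G.degree v + 1

variable (G) in
/-- The vertices of degree at least `m(G)`. -/
noncomputable def high : Finset V := univ.filter fun v => G.mDegree ≤ G.degree v

variable (G) in
/-- The vertices of degree `m(G) - 1`. -/
noncomputable def tight : Finset V := univ.filter fun v => G.degree v + 1 = G.mDegree

theorem mem_dense {v : V} : v ∈ G.dense ↔ G.mDegree ≤ G.degree v + 1 := by simp [dense]

theorem mem_high {v : V} : v ∈ G.high ↔ G.mDegree ≤ G.degree v := by simp [high]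

theorem mem_tight {v : V} : v ∈ G.tight ↔ G.degree v + 1 = G.mDegree := by simp [tight]

theorem dense_eq : G.dense = G.high ∪ G.tight := by
  ext v
  simp only [mem_union, mem_dense, mem_high, mem_tight]
  omega

/-- With more than `m(G)` vertices of degree at least `m(G)`, the number `m(G) + 1` would be
admissible in the definition of the m-degree. -/
theorem card_high_le : G.high.card ≤ G.mDegree := by
  by_contra! h
  have : G.mDegree + 1 ≤ G.mDegree := le_mDegree (by
    have : G.numDegGePred (G.mDegree + 1) = G.high.card := by
      simp only [numDegGePred, high, Nat.add_le_add_iff_right]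
    omega)
  omega

/-- A proper partial coloring can be extended to vertices of small degree. -/
theorem exists_coloring_extension {k : ℕ} (n : ℕ) : ∀ (P : Finset V) (c : V → Fin k),
    Pᶜ.card = n → (∀ u ∈ P, ∀ v ∈ P, G.Adj u v → c u ≠ c v) → (∀ v ∉ P, G.degree v < k) →
    ∃ c' : G.Coloring (Fin k), ∀ v ∈ P, c' v = c v := by
  induction n with
  | zero =>
    intro P c hP hc _
    have hP : ∀ v, v ∈ P := by
      intro v
      have := card_eq_zero.1 hP
      by_contra h
      have : v ∈ Pᶜ := by simpa using h
      simp_all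
    exact ⟨Coloring.mk c fun {u v} h => hc u (hP u) v (hP v) h, fun v _ => rfl⟩
  | succ n ih =>
    intro P c hP hc hdeg
    obtain ⟨v, hv⟩ := card_pos.1 (by omega : 0 < Pᶜ.card)
    have hv : v ∉ P := by simpa using hv
    -- Fewer than `k` neighbors carry fewer than `k` values. Uncolored neighbors have junk values
    -- under `c`, and avoiding these as well does no harm.
    have : ∃ a : Fin k, a ∉ (G.neighborFinset v).image c := by
      by_contra! h
      have h1 := (card_le_card (fun a _ => h a : univ ⊆ (G.neighborFinset v).image c)).trans
        card_image_le
      have := hdeg v hv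
      simp at h1
      omega
    obtain ⟨a, ha⟩ := this
    have ha : ∀ w, G.Adj v w → c w ≠ a := by simpa using ha
    refine Exists.elim (ih (insert v P) (Function.update c v a) ?_ ?_ ?_) fun c' hc' => ?_
    pick_goal 4
    · refine ⟨c', fun w hw => ?_⟩
      rw [hc' w (mem_insert_of_mem hw), Function.update_of_ne (by rintro rfl; exact hv hw)]
    · rw [compl_insert, card_erase_of_mem (by simpa using hv)]
      omega
    · intro u hu w hw huw
      by_cases h1 : u = v
      · subst h1
        rw [Function.update_self, Function.update_of_ne huw.ne']
        exact (ha w huw).symm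
      · rw [Function.update_of_ne h1]
        by_cases h2 : w = v
        · subst h2
          rw [Function.update_self]
          exact ha u huw.symm
        · rw [Function.update_of_ne h2]
          exact hc u (mem_of_mem_insert_of_ne hu h1) w (mem_of_mem_insert_of_ne hw h2) huw
    · intro w hw
      exact hdeg w fun h => hw (mem_insert_of_mem h)

/-! ### The reduction -/

section Reduction

variable {W : Type*} [Fintype W] {G' : SimpleGraph W} {e : W ↪ V}
  (hG' : ∀ u w, G'.Adj u w ↔ G.Adj (e u) (e w))
include hG'

theorem degree_comap_le (w : W) : G'.degree w ≤ G.degree (e w) := by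
  rw [← card_neighborFinset_eq_degree, ← card_neighborFinset_eq_degree]
  refine card_le_card_of_injOn e (fun u hu => ?_) e.injective.injOn
  simpa [hG'] using hu

variable (he : ∀ v, v ∈ Set.range e ↔ v ∈ G.closedNbhdOf G.dense)
include he

theorem degree_comap_eq {w : W} (hw : e w ∈ G.dense) :
    G'.degree w = G.degree (e w) := by
  refine le_antisymm (degree_comap_le hG' w) ?_
  rw [← card_neighborFinset_eq_degree, ← card_neighborFinset_eq_degree,
    ← card_map e (s := G'.neighborFinset w)]
  refine card_le_card fun v hv => ?_
  have hv : G.Adj (e w) v := by simpa using hv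
  obtain ⟨u, rfl⟩ := (he v).2 (mem_closedNbhdOf.2 ⟨_, hw, Or.inr hv⟩)
  simpa [hG'] using hv

omit hG' [Fintype W] in
theorem exists_of_mem_dense {v : V} (hv : v ∈ G.dense) : ∃ w, e w = v :=
  (he v).2 (mem_closedNbhdOf.2 ⟨v, hv, Or.inl rfl⟩)

/-- No degree grows under the restriction, and the dense vertices all survive with unchanged degree.
-/
theorem mDegree_comap : G'.mDegree = G.mDegree := by
  refine le_antisymm (le_mDegree ?_) (le_mDegree ?_)
  · refine mDegree_le_numDegGePred.trans
      (card_le_card_of_injOn e (fun w hw => ?_) e.injective.injOn)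
    have : G'.mDegree ≤ G'.degree w + 1 := by simpa using hw
    simpa using this.trans (Nat.succ_le_succ (degree_comap_le hG' w))
  · refine mDegree_le_numDegGePred.trans ?_
    unfold numDegGePred
    rw [← card_map e]
    refine card_le_card fun v hv => ?_
    have hv : v ∈ G.dense := by simpa [mem_dense] using hv
    obtain ⟨w, rfl⟩ := exists_of_mem_dense he hv
    have := degree_comap_eq hG' he hv
    rw [mem_dense] at hv
    simpa [this] using hv

/-- Since `m(G) ≤ Δ(G) + 1`, a vertex of maximum degree is dense and keeps its degree. -/
theorem maxDeg_comap : G'.maxDeg = G.maxDeg := by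
  cases isEmpty_or_nonempty V with
  | inl h =>
    have : IsEmpty W := ⟨fun w => h.elim (e w)⟩
    simp [maxDeg]
  | inr h =>
    obtain ⟨v, hv⟩ := exists_degree_eq_maxDeg (G := G)
    have hd : v ∈ G.dense := mem_dense.2 (by rw [hv]; exact mDegree_le_maxDeg_succ)
    obtain ⟨w, rfl⟩ := exists_of_mem_dense he hd
    refine le_antisymm ?_ ?_
    · have : Nonempty W := ⟨w⟩
      obtain ⟨u, hu⟩ := exists_degree_eq_maxDeg (G := G')
      rw [← hu]
      exact (degree_comap_le hG' u).trans (degree_le_maxDeg _)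
    · rw [← hv, ← degree_comap_eq hG' he hd]
      exact degree_le_maxDeg w

/-- Every b-vertex of `G` is dense, so it survives with all its neighbors and a b-coloring
restricts. In the other direction the vertices not kept have degree below `m(G)` and are colored
greedily. -/
theorem hasBColoring_comap_iff :
    G'.HasBColoring G'.mDegree ↔ G.HasBColoring G.mDegree := by
  rw [mDegree_comap hG' he]
  constructor
  · rintro ⟨c, hc⟩
    cases isEmpty_or_nonempty V with
    | inl h =>
      refine ⟨Coloring.mk (fun v => h.elim v) fun {v} => h.elim v, fun i => ?_⟩
      exact h.elim (e (hc i).choose)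
    | inr h =>
      have hk : 0 < G.mDegree := mDegree_pos
      refine Exists.elim (exists_coloring_extension (G := G) _ (G.closedNbhdOf G.dense)
        (fun v => if h : ∃ w, e w = v then c h.choose else ⟨0, hk⟩) rfl ?_ ?_) fun c' hc' => ?_
      pick_goal 3
      · have key : ∀ w, c' (e w) = c w := by
          intro w
          have hex : ∃ w', e w' = e w := ⟨w, rfl⟩
          rw [hc' _ ((he _).1 ⟨w, rfl⟩), dif_pos hex, e.injective hex.choose_spec]
        refine ⟨c', fun i => ?_⟩
        obtain ⟨x, hx, hxy⟩ := hc i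
        refine ⟨e x, (key x).trans hx, fun j hj => ?_⟩
        obtain ⟨y, hy, hyj⟩ := hxy j hj
        exact ⟨e y, (hG' _ _).1 hy, (key y).trans hyj⟩
      · intro u hu v hv huv
        obtain ⟨a, rfl⟩ := (he u).2 hu
        obtain ⟨b, rfl⟩ := (he v).2 hv
        have ha : ∃ w', e w' = e a := ⟨a, rfl⟩
        have hb : ∃ w', e w' = e b := ⟨b, rfl⟩
        simp only [dif_pos ha, dif_pos hb, e.injective ha.choose_spec, e.injective hb.choose_spec]
        exact c.valid ((hG' _ _).2 huv)
      · intro v hv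
        by_contra! h
        exact hv (mem_closedNbhdOf.2 ⟨v, mem_dense.2 (by omega), Or.inl rfl⟩)
  · rintro ⟨c, hc⟩
    refine ⟨Coloring.mk (fun w => c (e w)) fun {u v} h => c.valid ((hG' _ _).1 h), fun i => ?_⟩
    obtain ⟨x, hx, hxy⟩ := hc i
    have hd : x ∈ G.dense := by
      rw [mem_dense]
      have : univ.erase i ⊆ (G.neighborFinset x).image c := by
        intro j hj
        obtain ⟨y, hy, hyj⟩ := hxy j (by simpa using hj)
        exact mem_image.2 ⟨y, by simpa using hy, hyj⟩
      have := (card_le_card this).trans card_image_le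
      simp at this
      omega
    obtain ⟨w, rfl⟩ := exists_of_mem_dense he hd
    refine ⟨w, hx, fun j hj => ?_⟩
    obtain ⟨y, hy, hyj⟩ := hxy j hj
    obtain ⟨u, rfl⟩ := (he y).2 (mem_closedNbhdOf.2 ⟨_, hd, Or.inr hy⟩)
    exact ⟨u, (hG' _ _).2 hy, hyj⟩

end Reduction

/-! ### Graphs with many vertices of large degree -/

/-- If the sets `B x` are small, then a large set contains many elements that avoid the sets of
each other. -/
theorem exists_pairwise_notMem {S : Finset V} {B : V → Finset V} {b : ℕ} (hB : ∀ x, (B x).card ≤ b)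
    (hb : 0 < b) (hself : ∀ x, x ∈ B x) (hsymm : ∀ x y, x ∈ B y → y ∈ B x) (k : ℕ)
    (hk : k * b ≤ S.card) : ∃ T ⊆ S, T.card = k ∧ ∀ x ∈ T, ∀ y ∈ T, x ≠ y → y ∉ B x := by
  induction k with
  | zero => exact ⟨∅, by simp, by simp, by simp⟩
  | succ k ih =>
    obtain ⟨T, hTS, hTk, hT⟩ := ih ((Nat.mul_le_mul_right b (Nat.le_succ k)).trans hk)
    -- The sets of the `k` elements chosen so far cover at most `k * b` elements, fewer than `S`
    -- has.
    obtain ⟨y, hy, hyT⟩ : ∃ y ∈ S, ∀ x ∈ T, y ∉ B x := by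
      by_contra! h
      have h1 : S ⊆ T.biUnion B := fun y hy => mem_biUnion.2 (h y hy)
      have h2 := (card_le_card h1).trans (card_biUnion_le_card_mul _ _ _ fun x _ => hB x)
      rw [hTk] at h2
      rw [Nat.succ_mul] at hk
      omega
    have hyT' : y ∉ T := fun h => hyT y h (hself y)
    refine ⟨insert y T, insert_subset hy hTS, by rw [card_insert_of_notMem hyT', hTk], ?_⟩
    intro u hu w hw huw
    rcases mem_insert.1 hu with rfl | hu
    · rcases mem_insert.1 hw with rfl | hw
      · exact absurd rfl huw
      · exact fun h => hyT w hw (hsymm _ _ h)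
    · rcases mem_insert.1 hw with hwy | hw
      · exact hwy ▸ hyT u hu
      · exact hT u hu w hw huw

/-- The edges that avoid a set of vertices. -/
def avoiding (G : SimpleGraph V) (H : Finset V) : SimpleGraph V where
  Adj u v := G.Adj u v ∧ u ∉ H ∧ v ∉ H
  symm := ⟨fun _ _ h => ⟨h.1.symm, h.2.2, h.2.1⟩⟩
  loopless := ⟨fun _ h => h.1.ne rfl⟩

/-- Walks of length at most three can be reversed. This is the symmetry that
`exists_pairwise_notMem` asks for. -/
theorem mem_closedNbhdOf_comm {u v : V} :
    u ∈ G.closedNbhdOf (G.closedNbhdOf (G.closedNbhdOf {v})) ↔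
      v ∈ G.closedNbhdOf (G.closedNbhdOf (G.closedNbhdOf {u})) := by
  suffices H : ∀ u v : V, u ∈ G.closedNbhdOf (G.closedNbhdOf (G.closedNbhdOf {v})) →
      v ∈ G.closedNbhdOf (G.closedNbhdOf (G.closedNbhdOf {u})) from ⟨H u v, H v u⟩
  intro u v h
  obtain ⟨a, ha, h1⟩ := mem_closedNbhdOf.1 h
  obtain ⟨b, hb, h2⟩ := mem_closedNbhdOf.1 ha
  obtain ⟨c, hc, h3⟩ := mem_closedNbhdOf.1 hb
  obtain rfl := mem_singleton.1 hc
  exact mem_closedNbhdOf.2 ⟨b, mem_closedNbhdOf.2 ⟨a, mem_closedNbhdOf.2 ⟨u, mem_singleton_self u,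
    h1.imp Eq.symm fun h => h.symm⟩, h2.imp Eq.symm fun h => h.symm⟩,
    h3.imp Eq.symm fun h => h.symm⟩

omit [Fintype V] in
-- Any bijection of `S` with the colors, followed by the transposition that brings the color of `x`
-- to `i`.
theorem exists_rainbow {k : ℕ} {S : Finset V} (hS : S.card = k) {x : V} (hx : x ∈ S) (i : Fin k) :
    ∃ g : V → Fin k, g x = i ∧ Set.InjOn g S ∧ ∀ j, ∃ y ∈ S, g y = j := by
  let f := S.equivFinOfCardEq hS
  let f' := f.trans (Equiv.swap (f ⟨x, hx⟩) i)
  refine ⟨fun y => if h : y ∈ S then f' ⟨y, h⟩ else i, by simp [f', hx], ?_, fun j => ?_⟩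
  · intro a ha b hb hab
    simp only [mem_coe] at ha hb
    simpa [ha, hb] using hab
  · exact ⟨f'.symm j, (f'.symm j).2, by simp⟩

/-- Vertices of degree `k - 1` that are far apart and far from the vertices of larger degree can be
made b-vertices. -/
theorem hasBColoring_of_tight {x : Fin G.mDegree → V} (htight : ∀ i, x i ∈ G.tight)
    (hhigh : ∀ i, ∀ a ∈ G.closedNbhd (x i), a ∉ G.closedNbhdOf G.high)
    (hfar : ∀ i j, i ≠ j → ∀ a ∈ G.closedNbhd (x i), ∀ b ∈ G.closedNbhd (x j),
      a ≠ b ∧ ¬ G.Adj a b) : G.HasBColoring G.mDegree := by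
  have hcard : ∀ i, (G.closedNbhd (x i)).card = G.mDegree := fun i =>
    (card_closedNbhd _).trans (mem_tight.1 (htight i))
  have hself : ∀ i, x i ∈ G.closedNbhd (x i) := fun i => mem_closedNbhd.2 (Or.inl rfl)
  choose g hgx hginj hgsurj using fun i => exists_rainbow (hcard i) (hself i) i
  cases isEmpty_or_nonempty V with
  | inl h =>
    refine ⟨Coloring.mk (fun v => h.elim v) fun {v} => h.elim v, fun i => h.elim (x i)⟩
  | inr h =>
    have hk : 0 < G.mDegree := mDegree_pos
    have : Nonempty (Fin G.mDegree) := ⟨⟨0, hk⟩⟩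
    -- There are at most as many high vertices as colors. Distinct colors on them settle the edges
    -- among them, and `hhigh` excludes edges from them to the chosen closed neighborhoods.
    obtain ⟨f, -, hf⟩ := (G.high.finite_toSet).exists_injOn_of_encard_le
      (t := (Set.univ : Set (Fin G.mDegree))) (by simpa using card_high_le)
    let c : V → Fin G.mDegree := fun v =>
      if h : ∃ i, v ∈ G.closedNbhd (x i) then g h.choose v else f v
    have hc1 : ∀ i, ∀ v ∈ G.closedNbhd (x i), c v = g i v := by
      intro i v hv
      have h : ∃ i, v ∈ G.closedNbhd (x i) := ⟨i, hv⟩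
      have hi : h.choose = i := by
        by_contra hne
        exact (hfar _ _ hne v h.choose_spec v hv).1 rfl
      simp only [c, dif_pos h, hi]
    have hc2 : ∀ v ∈ G.high, c v = f v := by
      intro v hv
      have h : ¬ ∃ i, v ∈ G.closedNbhd (x i) := by
        rintro ⟨i, hi⟩
        exact hhigh i v hi (mem_closedNbhdOf.2 ⟨v, hv, Or.inl rfl⟩)
      simp only [c, dif_neg h]
    refine Exists.elim (exists_coloring_extension (G := G) _
      (G.high ∪ univ.biUnion fun i => G.closedNbhd (x i)) c rfl ?_ ?_) fun c' hc' => ?_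
    pick_goal 3
    · have key : ∀ i, ∀ v ∈ G.closedNbhd (x i), c' v = g i v := fun i v hv =>
        (hc' v (mem_union_right _ (mem_biUnion.2 ⟨i, mem_univ i, hv⟩))).trans (hc1 i v hv)
      refine ⟨c', fun i => ⟨x i, (key i _ (hself i)).trans (hgx i), fun j hj => ?_⟩⟩
      obtain ⟨y, hy, hyj⟩ := hgsurj i j
      refine ⟨y, ?_, (key i y hy).trans hyj⟩
      rcases mem_closedNbhd.1 hy with rfl | h
      · exact absurd (hyj.symm.trans (hgx i)) hj
      · exact h
    · intro u hu v hv huv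
      simp only [mem_union, mem_biUnion, mem_univ, true_and] at hu hv
      rcases hu with hu | ⟨i, hi⟩
      · rcases hv with hv | ⟨j, hj⟩
        · rw [hc2 u hu, hc2 v hv]
          exact fun h => huv.ne (hf hu hv h)
        · exact absurd (mem_closedNbhdOf.2 ⟨u, hu, Or.inr huv⟩) (hhigh j v hj)
      · rcases hv with hv | ⟨j, hj⟩
        · exact absurd (mem_closedNbhdOf.2 ⟨v, hv, Or.inr huv.symm⟩) (hhigh i u hi)
        · by_cases hij : i = j
          · subst hij
            rw [hc1 i u hi, hc1 i v hj]
            exact fun h => huv.ne (hginj i hi hj h)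
          · exact absurd huv (hfar i j hij u hi v hj).2
    · intro v hv
      by_contra! h
      exact hv (mem_union_left _ (mem_high.2 h))

/-- A graph in which the vertices of degree at least `m(G) - 1` have a large neighborhood has a
b-coloring with `m(G)` colors. -/
theorem hasBColoring_of_card_lt
    (h : 6 * (G.mDegree ^ 4 * G.maxDeg) < (G.closedNbhdOf G.dense).card) :
    G.HasBColoring G.mDegree := by
  set k := G.mDegree with hk
  set D := G.maxDeg with hD
  have hkD : k ≤ D + 1 := mDegree_le_maxDeg_succ
  have hV : Nonempty V := by
    obtain ⟨v, -⟩ := card_pos.1 (Nat.zero_lt_of_lt h)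
    exact ⟨v⟩
  have hk0 : 0 < k := mDegree_pos
  -- The edgeless case has `k = 1`; afterwards `D + 1 ≤ 2 * D` is available.
  rcases Nat.eq_zero_or_pos D with hD0 | hD0
  · have hk1 : k = 1 := by omega
    rw [hk1]
    refine ⟨Coloring.mk (fun _ => 0) fun {u v} huv => ?_, fun i => ⟨Classical.arbitrary V,
      Subsingleton.elim _ _, fun j hj => absurd (Subsingleton.elim _ _) hj⟩⟩
    have h1 := (degree_le_maxDeg (G := G) u).trans_eq (hD.symm.trans hD0)
    have h2 : 0 < G.degree u := (G.degree_pos_iff_exists_adj u).2 ⟨v, huv⟩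
    omega
  have hhigh : G.high.card ≤ k := card_high_le
  have hN : (G.closedNbhdOf G.high).card ≤ k * (D + 1) :=
    (card_closedNbhdOf_le fun v _ => Nat.succ_le_succ (degree_le_maxDeg v)).trans
      (Nat.mul_le_mul_right _ hhigh)
  have hT : (G.closedNbhdOf G.tight).card ≤ G.tight.card * k :=
    card_closedNbhdOf_le fun v hv => (mem_tight.1 hv).le
  have hW : (G.closedNbhdOf G.dense).card ≤ k * (D + 1) + G.tight.card * k := by
    refine (card_le_card (t := G.closedNbhdOf G.high ∪ G.closedNbhdOf G.tight) ?_).trans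
      ((card_union_le _ _).trans (Nat.add_le_add hN hT))
    rw [dense_eq, closedNbhdOf, union_biUnion]
    rfl
  -- The first summand pays for the tight vertices near high ones, the second for `k` greedy choices
  -- with balls of size `k ^ 3`. If this failed, `N` would have at most `2 * k ^ 4 * D + 4 * k ^ 4 *
  -- D` vertices, whence the constant `6`.
  have htight : k * (k * (D + 1)) + k * k ^ 3 ≤ G.tight.card := by
    by_contra! hlt
    have h1 : k * (D + 1) + G.tight.card * k ≤ 6 * (k ^ 4 * D) := by
      have hk2 : k ≤ 2 * D := by omega
      have a1 : G.tight.card ≤ k * (k * (D + 1)) + k * k ^ 3 := hlt.le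
      have a2 : k * (k * (D + 1)) + k * k ^ 3 ≤ k ^ 3 * (4 * D) := by
        have b1 : k * (k * (D + 1)) ≤ k ^ 3 * (2 * D) := by
          calc k * (k * (D + 1)) = k ^ 2 * (D + 1) := by ring
            _ ≤ k ^ 3 * (2 * D) :=
              Nat.mul_le_mul (Nat.pow_le_pow_right hk0 (by omega)) (by omega)
        have b2 : k * k ^ 3 ≤ k ^ 3 * (2 * D) := by
          rw [mul_comm]; exact Nat.mul_le_mul_left _ hk2
        calc _ ≤ k ^ 3 * (2 * D) + k ^ 3 * (2 * D) := Nat.add_le_add b1 b2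
          _ = _ := by ring
      have a3 : k * (D + 1) ≤ k ^ 4 * (2 * D) :=
        Nat.mul_le_mul (Nat.le_self_pow (by omega) k) (by omega)
      calc k * (D + 1) + G.tight.card * k ≤ k ^ 4 * (2 * D) + k ^ 3 * (4 * D) * k :=
            Nat.add_le_add a3 (Nat.mul_le_mul_right _ (a1.trans a2))
        _ = 6 * (k ^ 4 * D) := by ring
    omega
  -- In `L` closed neighborhoods have at most `k` elements instead of `D + 1`, so only one factor
  -- `D` enters the bound.
  let L := G.avoiding G.high
  have hL : ∀ v, L.degree v + 1 ≤ k := by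
    intro v
    by_cases hv : v ∈ G.high
    · have : L.degree v = 0 := by
        rw [← card_neighborFinset_eq_degree, card_eq_zero]
        ext w
        rw [mem_neighborFinset]
        simp [L, avoiding, hv]
      omega
    · have h1 : L.degree v ≤ G.degree v := by
        rw [← card_neighborFinset_eq_degree, ← card_neighborFinset_eq_degree]
        refine card_le_card fun w hw => ?_
        have : L.Adj v w := by simpa using hw
        simpa using this.1
      rw [mem_high] at hv
      omega
  have hLN : ∀ S, (L.closedNbhdOf S).card ≤ S.card * k := fun S =>
    card_closedNbhdOf_le fun v _ => hL v
  -- If the closed neighborhood of a tight vertex meets that of the high vertices, the vertex is at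
  -- most one further step away, and this step can be taken in `L`.
  let S := G.tight \ L.closedNbhdOf (G.closedNbhdOf G.high)
  have hS : k * k ^ 3 ≤ S.card := by
    have h1 := le_card_sdiff (L.closedNbhdOf (G.closedNbhdOf G.high)) G.tight
    have h2 := (hLN (G.closedNbhdOf G.high)).trans (Nat.mul_le_mul_right k hN)
    rw [mul_comm] at h2
    change _ ≤ S.card at h1
    omega
  obtain ⟨T, hTS, hTk, hfar⟩ := exists_pairwise_notMem (S := S)
    (B := fun v => L.closedNbhdOf (L.closedNbhdOf (L.closedNbhdOf {v}))) (b := k ^ 3)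
    (fun v => by
      refine (hLN _).trans ((Nat.mul_le_mul_right k ((hLN _).trans
        (Nat.mul_le_mul_right k (hLN _)))).trans_eq ?_)
      simp
      ring)
    (by positivity)
    (fun v => mem_closedNbhdOf.2 ⟨v, mem_closedNbhdOf.2 ⟨v, mem_closedNbhdOf.2 ⟨v, by simp⟩,
      Or.inl rfl⟩, Or.inl rfl⟩)
    (fun u v => mem_closedNbhdOf_comm.1) k hS
  have hnot : ∀ v ∈ T, ∀ a ∈ G.closedNbhd v, a ∉ G.closedNbhdOf G.high := by
    intro v hv a ha hah
    have hv := mem_sdiff.1 (hTS hv)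
    have hvh : v ∉ G.high := by
      have := mem_tight.1 hv.1
      rw [mem_high]
      omega
    apply hv.2
    rcases mem_closedNbhd.1 ha with rfl | hva
    · exact mem_closedNbhdOf.2 ⟨a, hah, Or.inl rfl⟩
    by_cases hah' : a ∈ G.high
    · exact mem_closedNbhdOf.2 ⟨v, mem_closedNbhdOf.2 ⟨a, hah', Or.inr hva.symm⟩, Or.inl rfl⟩
    · exact mem_closedNbhdOf.2 ⟨a, hah, Or.inr ⟨hva.symm, hah', hvh⟩⟩
  have hnot' : ∀ v ∈ T, ∀ a ∈ G.closedNbhd v, a ∉ G.high := fun v hv a ha h =>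
    hnot v hv a ha (mem_closedNbhdOf.2 ⟨a, h, Or.inl rfl⟩)
  have hLadj : ∀ v ∈ T, ∀ a ∈ G.closedNbhd v, a = v ∨ L.Adj v a := by
    intro v hv a ha
    refine (mem_closedNbhd.1 ha).imp_right fun h => ⟨h, ?_, hnot' v hv a ha⟩
    exact hnot' v hv v (mem_closedNbhd.2 (Or.inl rfl))
  let x := (T.equivFinOfCardEq hTk).symm
  refine hasBColoring_of_tight (x := fun i => (x i : V))
    (fun i => (mem_sdiff.1 (hTS (x i).2)).1) (fun i => hnot _ (x i).2) fun i j hij a ha b hb => ?_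
  have hne : (x i : V) ≠ x j := fun h => hij (x.injective (Subtype.ext h))
  have hfar := hfar _ (x i).2 _ (x j).2 hne
  -- No vertex in the closed neighborhoods of `x i` and `x j` is high, so a common vertex or a
  -- joining edge would yield a walk of length at most three in `L`.
  have h1 := hLadj _ (x i).2 a ha
  have h2 := (hLadj _ (x j).2 b hb).imp Eq.symm fun h => h.symm
  constructor
  · rintro rfl
    exact hfar (mem_closedNbhdOf.2 ⟨a, mem_closedNbhdOf.2 ⟨a, mem_closedNbhdOf.2 ⟨x i,
      by simp, h1⟩, Or.inl rfl⟩, h2⟩)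
  · intro hab
    exact hfar (mem_closedNbhdOf.2 ⟨b, mem_closedNbhdOf.2 ⟨a, mem_closedNbhdOf.2 ⟨x i,
      by simp, h1⟩, Or.inr ⟨hab, hnot' _ (x i).2 a ha, hnot' _ (x j).2 b hb⟩⟩, h2⟩)

end SimpleGraph

/-! ## The kernelization algorithm -/

namespace RAM.Ex

/-- `1` if `a ≤ b`, otherwise `0`. -/
def le (a b : Ex) : Ex := .sub (.const 1) (.sub a b)

/-- `1` if `a = b`, otherwise `0`. -/
def eq (a b : Ex) : Ex := .sub (.const 1) (.add (.sub a b) (.sub b a))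

/-- `1` if `a ≠ 0`, otherwise `0`. -/
def sign (a : Ex) : Ex := .sub (.const 1) (.sub (.const 1) a)

/-- `a + 1`. -/
def succ (a : Ex) : Ex := .add a (.const 1)

variable (m e : ℕ → ℕ) (a b : Ex)

theorem eval_le_eq : (le a b).eval m e = if a.eval m e ≤ b.eval m e then 1 else 0 := by
  simp only [le, eval]
  split_ifs <;> omega

theorem eval_eq_eq : (eq a b).eval m e = if a.eval m e = b.eval m e then 1 else 0 := by
  simp only [eq, eval]
  split_ifs <;> omega

theorem eval_sign : (sign a).eval m e = if a.eval m e ≠ 0 then 1 else 0 := by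
  simp only [sign, eval]
  split_ifs <;> omega

end RAM.Ex

namespace Parameterized

open Finset RAM RAM.Ex

/-! ### Values read off from an adjacency matrix -/

section Values

variable (m : ℕ → ℕ) (n : ℕ)

/-- The square root of a square. -/
def rootVal (l : ℕ) : ℕ := ∑ j ∈ range l, if (j + 1) * (j + 1) ≤ l then 1 else 0

/-- The degree of `v`. -/
def degVal (v : ℕ) : ℕ := ∑ u ∈ range n, m (v * n + u)

/-- The number of vertices of degree at least `i - 1`. -/
def countVal (i : ℕ) : ℕ := ∑ v ∈ range n, if i ≤ degVal m n v + 1 then 1 else 0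

/-- The m-degree. -/
def mDegVal : ℕ := ∑ j ∈ range n, if j + 1 ≤ countVal m n (j + 1) then 1 else 0

/-- Whether `v` is in the closed neighborhood of a vertex of degree at least `k - 1`. -/
def keptVal (k v : ℕ) : ℕ :=
  if (∑ u ∈ range n, ((if u = v then 1 else 0) + m (v * n + u)) *
    if k ≤ degVal m n u + 1 then 1 else 0) ≠ 0 then 1 else 0

/-- The number of kept vertices before `v`. -/
def rankVal (k v : ℕ) : ℕ := ∑ u ∈ range v, keptVal m n k u

/-- The kept vertex of rank `a`. -/
def posVal (k a : ℕ) : ℕ := ∑ v ∈ range n, if rankVal m n k (v + 1) ≤ a then 1 else 0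

/-- The quotient of `i` and `s`, if it is less than `s`. -/
def quotVal (s i : ℕ) : ℕ := ∑ j ∈ range s, if (j + 1) * s ≤ i then 1 else 0

/-- This is `0` if and only if the input is a graph with maximum degree `d`. -/
def defectVal (l d : ℕ) : ℕ :=
  (l - n * n) + (n * n - l) + ∑ u ∈ range n, m (u * n + u) +
    ∑ u ∈ range n, ∑ v ∈ range n, (m (u * n + v) - m (v * n + u)) +
    ∑ v ∈ range n, (degVal m n v - d) +
    -- The maximum must be attained only if `d ≠ 0`: the graph without vertices has maximum degree
    -- `0` and no vertex attaining it.
    ((if d ≠ 0 then 1 else 0) - ∑ v ∈ range n, if d ≤ degVal m n v then 1 else 0)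

end Values

/-! ### Their expressions

The variables `0` to `5` are the length of the input, the parameter, the index of an entry of the
output, the number of vertices, the m-degree and the number of kept vertices. -/

/-- Nested sums bind different variables, so that nothing is captured. Side conditions such as `v ≠
11` below express this. -/
def rootEx : Ex := .sum 10 (.var 0) (le (.mul (succ (.var 10)) (succ (.var 10))) (.var 0))

def entryEx (u v : ℕ) : Ex := .load (.add (.mul (.var u) (.var 3)) (.var v))

def degEx (v : ℕ) : Ex := .sum 11 (.var 3) (entryEx v 11)

def countEx (i : ℕ) : Ex := .sum 12 (.var 3) (le (.var i) (succ (degEx 12)))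

def mDegEx : Ex :=
  .sum 13 (.var 3) (.bind 14 (succ (.var 13)) (le (.var 14) (countEx 14)))

def keptEx (v : ℕ) : Ex :=
  sign (.sum 15 (.var 3)
    (.mul (.add (eq (.var 15) (.var v)) (entryEx v 15)) (le (.var 4) (succ (degEx 15)))))

def rankEx (a : Ex) : Ex := .sum 16 a (keptEx 16)

def posEx (a : ℕ) : Ex := .sum 17 (.var 3) (le (rankEx (succ (.var 17))) (.var a))

def quotEx : Ex := .sum 18 (.var 5) (le (.mul (succ (.var 18)) (.var 5)) (.var 2))

def defectEx : Ex :=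
  .add (.add (.add (.add
    (.add (.sub (.var 0) (.mul (.var 3) (.var 3))) (.sub (.mul (.var 3) (.var 3)) (.var 0)))
    (.sum 19 (.var 3) (entryEx 19 19)))
    (.sum 19 (.var 3) (.sum 20 (.var 3) (.sub (entryEx 19 20) (entryEx 20 19)))))
    (.sum 19 (.var 3) (.sub (degEx 19) (.var 1))))
    (.sub (sign (.var 1)) (.sum 19 (.var 3) (le (.var 1) (degEx 19))))

/-- Compute the number of vertices, the m-degree and the number of kept vertices. -/
def withGlobals (b : Ex) : Ex := .bind 3 rootEx (.bind 4 mDegEx (.bind 5 (rankEx (.var 3)) b))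

/-- The first factor is `1` on valid inputs and `0` otherwise, the second is `2` if few vertices are
kept and `1` if many. The products `0`, `1`, `2` are the codes for "no", "yes" and a new instance.
-/
def codeEx : Ex := withGlobals (.mul (.sub (.const 1) defectEx) (succ (le (.var 5)
  (.mul (.const 6) (.mul (.mul (.mul (.var 4) (.var 4)) (.mul (.var 4) (.var 4))) (.var 1))))))

def lenEx : Ex := withGlobals (.mul (.var 5) (.var 5))

def valEx : Ex := withGlobals (.bind 6 quotEx (.bind 7 (.sub (.var 2) (.mul (.var 6) (.var 5)))
  (.bind 8 (posEx 6) (.bind 9 (posEx 7) (entryEx 8 9)))))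

section Eval

variable (m e : ℕ → ℕ)

theorem eval_rootEx : rootEx.eval m e = rootVal (e 0) := by
  simp [rootEx, eval, eval_le_eq, succ, rootVal]

theorem eval_degEx {v : ℕ} (hv : v ≠ 11) : (degEx v).eval m e = degVal m (e 3) (e v) := by
  simp [degEx, entryEx, eval, degVal, hv]

theorem eval_countEx {i : ℕ} (hi : i ≠ 12) : (countEx i).eval m e = countVal m (e 3) (e i) := by
  simp [countEx, eval, eval_le_eq, succ, eval_degEx, countVal, hi]

theorem eval_mDegEx : mDegEx.eval m e = mDegVal m (e 3) := by
  simp [mDegEx, eval, eval_le_eq, succ, eval_countEx, mDegVal]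

theorem eval_keptEx {v : ℕ} (hv : v ≠ 15) :
    (keptEx v).eval m e = keptVal m (e 3) (e 4) (e v) := by
  simp only [keptEx, eval_sign]
  simp [entryEx, eval, eval_le_eq, eval_eq_eq, succ, eval_degEx, keptVal, hv]

theorem eval_rankEx (a : Ex) :
    (rankEx a).eval m e = rankVal m (e 3) (e 4) (a.eval m e) := by
  simp [rankEx, eval, eval_keptEx, rankVal]

theorem eval_posEx {a : ℕ} (ha : a ≠ 17) :
    (posEx a).eval m e = posVal m (e 3) (e 4) (e a) := by
  simp [posEx, eval, eval_le_eq, succ, eval_rankEx, posVal, ha]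

theorem eval_quotEx : quotEx.eval m e = quotVal (e 5) (e 2) := by
  simp [quotEx, eval, eval_le_eq, succ, quotVal]

theorem eval_defectEx : defectEx.eval m e = defectVal m (e 3) (e 0) (e 1) := by
  simp only [defectEx, eval, eval_sign, eval_le_eq]
  simp only [entryEx, eval, eval_degEx, defectVal, ne_eq, Function.update_self,
    not_false_eq_true, Function.update_of_ne, Nat.reduceEqDiff, OfNat.one_ne_ofNat]
  congr!

/-- The values of the variables `3`, `4` and `5`. -/
def globals : ℕ → ℕ :=
  let n := rootVal (e 0)
  let k := mDegVal m n
  Function.update (Function.update (Function.update e 3 n) 4 k) 5 (rankVal m n k n)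

theorem eval_withGlobals (b : Ex) : (withGlobals b).eval m e = b.eval m (globals m e) := by
  simp [withGlobals, eval, globals, eval_rootEx, eval_mDegEx, eval_rankEx]

variable (l d : ℕ)

theorem eval_codeEx :
    codeEx.eval m (inputVal l d) =
      let n := rootVal l
      let k := mDegVal m n
      (1 - defectVal m n l d) *
        ((if rankVal m n k n ≤ 6 * (k ^ 4 * d) then 1 else 0) + 1) := by
  have h4 : ∀ k : ℕ, k * k * (k * k) = k ^ 4 := fun k => by ring
  simp [codeEx, eval_withGlobals, eval, eval_defectEx, succ, eval_le_eq, globals, inputVal, h4]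

theorem eval_lenEx :
    lenEx.eval m (inputVal l d) =
      let n := rootVal l
      let k := mDegVal m n
      rankVal m n k n * rankVal m n k n := by
  simp [lenEx, eval_withGlobals, eval, globals, inputVal]

theorem eval_valEx (i : ℕ) :
    valEx.eval m (Function.update (inputVal l d) 2 i) =
      let n := rootVal l
      let k := mDegVal m n
      let s := rankVal m n k n
      m (posVal m n k (quotVal s i) * n + posVal m n k (i - quotVal s i * s)) := by
  simp [valEx, eval_withGlobals, eval, globals, inputVal, eval_quotEx,
    eval_posEx, entryEx]

end Eval

/-! ### The values for a graph -/

theorem sum_range_ite_lt (s q : ℕ) : (∑ j ∈ range s, if j < q then 1 else 0) = min s q := by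
  rw [← card_filter]
  have : (range s).filter (fun j => j < q) = range (min s q) := by
    ext j; simp
  rw [this, card_range]

theorem rootVal_mul_self (n : ℕ) : rootVal (n * n) = n := by
  have : rootVal (n * n) = ∑ j ∈ range (n * n), if j < n then 1 else 0 :=
    sum_congr rfl fun j _ => if_congr Nat.mul_self_le_mul_self_iff rfl rfl
  rw [this, sum_range_ite_lt, min_eq_right (Nat.le_mul_self n)]

theorem quotVal_eq {s i : ℕ} (h : i < s * s) : quotVal s i = i / s := by
  have hs : 0 < s := Nat.pos_of_ne_zero (by rintro rfl; simp at h)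
  have : quotVal s i = ∑ j ∈ range s, if j < i / s then 1 else 0 :=
    sum_congr rfl fun j _ => if_congr (Nat.le_div_iff_mul_le hs).symm rfl rfl
  rw [this, sum_range_ite_lt, min_eq_right (Nat.div_lt_of_lt_mul h).le]

section Rank

variable {p : ℕ → Prop} [DecidablePred p]

theorem exists_count_eq {a n : ℕ} (h : a < Nat.count p n) : ∃ v < n, p v ∧ Nat.count p v = a := by
  induction n with
  | zero => simp at h
  | succ n ih =>
    by_cases ha : a < Nat.count p n
    · obtain ⟨v, hv, h1⟩ := ih ha
      exact ⟨v, hv.trans (Nat.lt_succ_self n), h1⟩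
    · rw [Nat.count_succ] at h
      split_ifs at h with hn
      · exact ⟨n, Nat.lt_succ_self n, hn, by omega⟩
      · omega

/-- The count jumps right after `v`, so the condition on `w` says `w < v`. Hence a bounded sum
recovers an element from its rank, as `posVal` does. -/
theorem sum_count_le {v n : ℕ} (hv : v ≤ n) (hpv : p v) :
    (∑ w ∈ range n, if Nat.count p (w + 1) ≤ Nat.count p v then 1 else 0) = v := by
  have h : ∀ w, Nat.count p (w + 1) ≤ Nat.count p v ↔ w < v := by
    intro w
    constructor
    · intro h
      by_contra! hvw
      have h1 := Nat.count_monotone p (Nat.succ_le_succ hvw)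
      simp only [Nat.succ_eq_add_one] at h1
      rw [Nat.count_succ p v, if_pos hpv] at h1
      omega
    · exact fun h => Nat.count_monotone p h
  simp only [h]
  rw [sum_range_ite_lt, min_eq_right hv]

end Rank

section Graph

open Classical

variable {n : ℕ} (G : SimpleGraph (Fin n))

theorem length_encodeGraph : (encodeGraph G).length = n * n := by simp [encodeGraph]

theorem bits_encodeGraph (u v : Fin n) :
    bits (encodeGraph G) (u * n + v) = if G.Adj u v then 1 else 0 := by
  have hn : 0 < n := u.pos
  have h : (u : ℕ) * n + v < n * n := by
    have := Nat.mul_le_mul_right n (Nat.succ_le_of_lt u.2)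
    rw [Nat.succ_mul] at this
    have := v.2
    omega
  have h1 : (⟨u * n + v, h⟩ : Fin (n * n)).divNat = u := by
    ext
    simp only [Fin.coe_divNat]
    rw [mul_comm, Nat.mul_add_div hn, Nat.div_eq_of_lt v.2, add_zero]
  have h2 : (⟨u * n + v, h⟩ : Fin (n * n)).modNat = v := by
    ext
    simp only [Fin.coe_modNat]
    rw [mul_comm, Nat.mul_add_mod, Nat.mod_eq_of_lt v.2]
  unfold bits
  rw [List.getD_eq_getElem _ _ (by rw [length_encodeGraph]; exact h)]
  simp [encodeGraph, h1, h2]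

theorem encodeGraph_injective {G G' : SimpleGraph (Fin n)} (h : encodeGraph G = encodeGraph G') :
    G = G' := by
  ext u v
  have h1 := bits_encodeGraph G u v
  rw [h, bits_encodeGraph G' u v] at h1
  split_ifs at h1 <;> simp_all

theorem degVal_encodeGraph (v : Fin n) : degVal (bits (encodeGraph G)) n v = G.degree v := by
  rw [degVal, sum_range]
  simp only [bits_encodeGraph]
  rw [← card_filter, ← SimpleGraph.card_neighborFinset_eq_degree,
    SimpleGraph.neighborFinset_eq_filter]

theorem countVal_encodeGraph (i : ℕ) :
    countVal (bits (encodeGraph G)) n i = G.numDegGePred i := by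
  rw [countVal, sum_range]
  simp only [degVal_encodeGraph]
  rw [← card_filter, SimpleGraph.numDegGePred]

/-- By monotonicity the admissible numbers form an initial segment, so counting the positive ones
gives the largest. -/
theorem mDegVal_encodeGraph : mDegVal (bits (encodeGraph G)) n = G.mDegree := by
  have h : ∀ j, (j + 1 ≤ G.numDegGePred (j + 1)) ↔ j < G.mDegree := by
    intro j
    refine ⟨fun h => SimpleGraph.le_mDegree h, fun h => ?_⟩
    exact (Nat.succ_le_of_lt h).trans (SimpleGraph.mDegree_le_numDegGePred.trans
      (SimpleGraph.numDegGePred_antitone h))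
  rw [mDegVal]
  simp only [countVal_encodeGraph, h]
  rw [sum_range_ite_lt, min_eq_right]
  simpa using SimpleGraph.mDegree_le_card (G := G)

theorem keptVal_encodeGraph (v : Fin n) : keptVal (bits (encodeGraph G)) n G.mDegree v =
    if v ∈ G.closedNbhdOf G.dense then 1 else 0 := by
  rw [keptVal, sum_range]
  refine if_congr ?_ rfl rfl
  simp only [bits_encodeGraph, degVal_encodeGraph]
  rw [Ne, sum_eq_zero_iff]
  simp only [SimpleGraph.mem_closedNbhdOf, SimpleGraph.mem_dense]
  push Not
  refine exists_congr fun u => ?_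
  simp only [Fin.val_inj, G.adj_comm u v, @eq_comm _ u v]
  by_cases h1 : v = u <;> by_cases h2 : G.Adj v u <;> simp [h1, h2]

/-- Whether the vertex with number `v` is kept. -/
def IsKept (v : ℕ) : Prop := ∃ h : v < n, (⟨v, h⟩ : Fin n) ∈ G.closedNbhdOf G.dense

theorem rankVal_encodeGraph {v : ℕ} (hv : v ≤ n) :
    rankVal (bits (encodeGraph G)) n G.mDegree v = Nat.count (IsKept G) v := by
  rw [Nat.count_eq_card_filter_range, card_filter, rankVal]
  refine sum_congr rfl fun u hu => ?_
  have hu : u < n := (mem_range.1 hu).trans_le hv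
  rw [show u = ((⟨u, hu⟩ : Fin n) : ℕ) from rfl, keptVal_encodeGraph]
  exact if_congr ⟨fun h => ⟨hu, h⟩, fun ⟨_, h⟩ => h⟩ rfl rfl

theorem posVal_count {v : ℕ} (hv : IsKept G v) :
    posVal (bits (encodeGraph G)) n G.mDegree (Nat.count (IsKept G) v) = v := by
  obtain ⟨h, _⟩ := id hv
  rw [posVal, ← sum_count_le h.le hv]
  refine sum_congr rfl fun w hw => ?_
  rw [rankVal_encodeGraph G (mem_range.1 hw), sum_count_le h.le hv]

/-- The embedding lists the kept vertices by rank. It links the computed positions with the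
hypotheses of the reduction. -/
theorem exists_embedding : ∃ e : Fin (Nat.count (IsKept G) n) ↪ Fin n,
    (∀ a : Fin (Nat.count (IsKept G) n), posVal (bits (encodeGraph G)) n G.mDegree a = e a) ∧
    ∀ v, v ∈ Set.range e ↔ v ∈ G.closedNbhdOf G.dense := by
  choose f hfn hf hfc using fun a : Fin (Nat.count (IsKept G) n) => exists_count_eq a.2
  refine ⟨⟨fun a => ⟨f a, hfn a⟩, fun a b h => ?_⟩, fun a => ?_, fun v => ⟨?_, fun h => ?_⟩⟩
  · have : f a = f b := by simpa using h
    ext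
    rw [← hfc a, ← hfc b, this]
  · change _ = f a
    rw [← posVal_count G (hf a), hfc]
  · rintro ⟨a, rfl⟩
    exact (hf a).2
  · have hv : IsKept G v := ⟨v.2, h⟩
    refine ⟨⟨Nat.count (IsKept G) v, Nat.count_strict_mono hv v.2⟩, ?_⟩
    ext
    change f _ = _
    rw [← posVal_count G (hf _), hfc, posVal_count G hv]

theorem card_kept : Nat.count (IsKept G) n = (G.closedNbhdOf G.dense).card := by
  obtain ⟨e, -, he⟩ := exists_embedding G
  have : G.closedNbhdOf G.dense = univ.map e := by
    ext v
    rw [← he]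
    simp
  rw [this, card_map, card_univ, Fintype.card_fin]

/-- A list is the adjacency matrix of a graph if it passes the test. -/
theorem exists_encodeGraph {x : List Bool} {d : ℕ}
    (h : defectVal (bits x) n x.length d = 0) : ∃ G : SimpleGraph (Fin n), x = encodeGraph G := by
  simp only [defectVal, Nat.add_eq_zero_iff, sum_eq_zero_iff, mem_range] at h
  obtain ⟨⟨⟨⟨⟨h1, h2⟩, h3⟩, h4⟩, -⟩, -⟩ := h
  have hlen : x.length = n * n := by omega
  refine ⟨⟨fun u v => bits x (u * n + v) ≠ 0, ⟨fun u v huv hvu => huv ?_⟩,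
    ⟨fun u huu => huu (h3 u u.2)⟩⟩, ?_⟩
  · have := h4 u u.2 v v.2
    omega
  · refine List.ext_getElem (by simp [hlen, encodeGraph]) fun i hi hi' => ?_
    have hn : i / n * n + i % n = i := by rw [mul_comm]; exact Nat.div_add_mod i n
    simp [encodeGraph, bits, hn, List.getElem?_eq_getElem hi]

theorem defectVal_encodeGraph {d : ℕ} :
    defectVal (bits (encodeGraph G)) n (n * n) d = 0 ↔ d = G.maxDeg := by
  have h3 : ∑ u ∈ range n, bits (encodeGraph G) (u * n + u) = 0 := by
    rw [sum_range]
    simp [bits_encodeGraph]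
  have h4 : ∑ u ∈ range n, ∑ v ∈ range n,
      (bits (encodeGraph G) (u * n + v) - bits (encodeGraph G) (v * n + u)) = 0 := by
    rw [sum_range]
    refine sum_eq_zero fun u _ => ?_
    rw [sum_range]
    refine sum_eq_zero fun v _ => ?_
    rw [bits_encodeGraph, bits_encodeGraph, G.adj_comm, Nat.sub_self]
  rw [defectVal, h3, h4, sum_range, sum_range]
  simp only [degVal_encodeGraph]
  rw [← card_filter]
  simp only [Nat.sub_self, zero_add, Nat.add_eq_zero_iff, sum_eq_zero_iff, mem_univ, true_implies]
  constructor
  · rintro ⟨h1, h2⟩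
    refine le_antisymm ?_ ?_
    · by_cases hd : d = 0
      · omega
      · rw [if_pos hd] at h2
        obtain ⟨v, hv⟩ := card_pos.1 (Nat.sub_eq_zero_iff_le.1 h2)
        exact (mem_filter.1 hv).2.trans (SimpleGraph.degree_le_maxDeg v)
    · cases isEmpty_or_nonempty (Fin n) with
      | inl h => simp [SimpleGraph.maxDeg]
      | inr h =>
        obtain ⟨v, hv⟩ := SimpleGraph.exists_degree_eq_maxDeg (G := G)
        rw [← hv]
        exact Nat.sub_eq_zero_iff_le.1 (h1 v)
  · rintro rfl
    refine ⟨fun v => Nat.sub_eq_zero_of_le (SimpleGraph.degree_le_maxDeg v), ?_⟩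
    split_ifs with h0
    · cases isEmpty_or_nonempty (Fin n) with
      | inl h => exact absurd (by simp [SimpleGraph.maxDeg]) h0
      | inr h =>
        obtain ⟨v, hv⟩ := SimpleGraph.exists_degree_eq_maxDeg (G := G)
        exact Nat.sub_eq_zero_of_le (card_pos.2 ⟨v, by simp [hv]⟩)
    · simp

end Graph

end Parameterized

/-! ### Correctness of the kernelization and size of the kernel -/

namespace Parameterized

open Finset RAM

/-- The kernelization algorithm. -/
def kernelProgram : Program := answerProgram codeEx lenEx valEx

/-- The new instance is the induced graph `G.comap e` on the kept vertices; the parameter is passed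
on unchanged, which `maxDeg_comap` justifies. -/
theorem answerOf_encodeGraph {n : ℕ} (G : SimpleGraph (Fin n)) :
    (answerOf codeEx lenEx valEx (encodeGraph G) G.maxDeg = Outcome.accept ∧
      6 * (G.mDegree ^ 4 * G.maxDeg) < (G.closedNbhdOf G.dense).card) ∨
    ∃ (n' : ℕ) (G' : SimpleGraph (Fin n')),
      answerOf codeEx lenEx valEx (encodeGraph G) G.maxDeg =
        Outcome.reduced (encodeGraph G') G.maxDeg ∧
      G'.maxDeg = G.maxDeg ∧ n' ≤ 6 * (G.mDegree ^ 4 * G.maxDeg) ∧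
      (G.HasBColoring G.mDegree ↔ G'.HasBColoring G'.mDegree) := by
  classical
  have hcode := eval_codeEx (bits (encodeGraph G)) (n * n) G.maxDeg
  have hlen := eval_lenEx (bits (encodeGraph G)) (n * n) G.maxDeg
  have hval := eval_valEx (bits (encodeGraph G)) (n * n) G.maxDeg
  simp only [rootVal_mul_self, mDegVal_encodeGraph, rankVal_encodeGraph G le_rfl,
    (defectVal_encodeGraph G).2 rfl] at hcode hlen hval
  simp only [answerOf, length_encodeGraph, hcode, hlen, hval]
  by_cases h : Nat.count (IsKept G) n ≤ 6 * (G.mDegree ^ 4 * G.maxDeg)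
  · refine Or.inr ?_
    obtain ⟨e, hpos, he⟩ := exists_embedding G
    have hG' : ∀ u w, (G.comap e).Adj u w ↔ G.Adj (e u) (e w) := fun _ _ => Iff.rfl
    refine ⟨_, G.comap e, ?_, SimpleGraph.maxDeg_comap hG' he, h,
      (SimpleGraph.hasBColoring_comap_iff hG' he).symm⟩
    simp only [if_pos h]
    norm_num
    refine List.ext_getElem (by simp [encodeGraph]) fun i hi hi' => ?_
    have hi : i < Nat.count (IsKept G) n * Nat.count (IsKept G) n := by simpa using hi
    have hs : 0 < Nat.count (IsKept G) n := Nat.pos_of_ne_zero fun h => by simp [h] at hi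
    have h1 := hpos ⟨i / _, Nat.div_lt_of_lt_mul hi⟩
    have h2 := hpos ⟨i % _, Nat.mod_lt i hs⟩
    have h3 : i - i / Nat.count (IsKept G) n * Nat.count (IsKept G) n =
        i % Nat.count (IsKept G) n := by
      rw [Nat.mod_eq_sub_div_mul]
    simp only at h1 h2
    simp only [List.getElem_map, List.getElem_range, quotVal_eq hi, h3, h1, h2, bits_encodeGraph]
    simp [encodeGraph]
    rfl
  · refine Or.inl ⟨?_, by rw [← card_kept]; omega⟩
    simp only [if_neg h]
    norm_num

/-- The length of an adjacency matrix determines the number of vertices, so a failed test for this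
single number excludes every graph. -/
theorem answerOf_cases (x : List Bool) (d : ℕ) :
    (∃ (n : ℕ) (G : SimpleGraph (Fin n)), x = encodeGraph G ∧ d = G.maxDeg) ∨
      (answerOf codeEx lenEx valEx x d = Outcome.reject ∧ (x, d) ∉ mDegreeBColoring) := by
  by_cases h : defectVal (bits x) (rootVal x.length) x.length d = 0
  · obtain ⟨G, hG⟩ := exists_encodeGraph h
    have hlen : x.length = _ := (congrArg List.length hG).trans (length_encodeGraph G)
    refine Or.inl ⟨_, G, hG, (defectVal_encodeGraph G).1 ?_⟩
    rwa [← hlen, ← hG]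
  · refine Or.inr ⟨?_, ?_⟩
    · have h1 : 1 - defectVal (bits x) (rootVal x.length) x.length d = 0 := by omega
      simp [answerOf, eval_codeEx, h1]
    · rintro ⟨n, G, hx, -⟩
      obtain ⟨rfl, rfl⟩ := Prod.mk.inj hx
      apply h
      rw [length_encodeGraph, rootVal_mul_self]
      exact (defectVal_encodeGraph G).2 rfl

/-- Membership only provides some graph with this encoding; as length and entries determine the
graph, it is `G`. -/
theorem mem_mDegreeBColoring {n : ℕ} (G : SimpleGraph (Fin n)) :
    (encodeGraph G, G.maxDeg) ∈ mDegreeBColoring ↔ G.HasBColoring G.mDegree := by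
  constructor
  · rintro ⟨n', G', h, hG'⟩
    obtain ⟨h1, -⟩ := Prod.mk.inj h
    have hn : n * n = n' * n' := by simpa only [length_encodeGraph] using congrArg List.length h1
    obtain rfl : n = n' := Nat.mul_self_inj.1 hn
    rwa [encodeGraph_injective h1]
  · exact fun h => ⟨n, G, rfl, h⟩

theorem mDegree_pow_mul_le {n : ℕ} (G : SimpleGraph (Fin n)) :
    G.mDegree ^ 4 * G.maxDeg ≤ 16 * G.maxDeg ^ 5 := by
  rcases Nat.eq_zero_or_pos G.maxDeg with h | h
  · simp [h]
  · have h1 : G.mDegree ≤ 2 * G.maxDeg := by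
      have := SimpleGraph.mDegree_le_maxDeg_succ (G := G)
      omega
    calc G.mDegree ^ 4 * G.maxDeg ≤ (2 * G.maxDeg) ^ 4 * G.maxDeg :=
          Nat.mul_le_mul_right _ (Nat.pow_le_pow_left h1 4)
      _ = _ := by ring

theorem isKernelization_kernelProgram : IsKernelization kernelProgram mDegreeBColoring := by
  -- The kernel has at most `6 * 16 * d ^ 5` vertices, its matrix has the square of that many
  -- entries, and `d` is the new parameter.
  refine ⟨answerProgram_poly _ _ _, fun d => (96 * d ^ 5) * (96 * d ^ 5) + d, ?_, ?_⟩
  · have hp : Primrec fun d : ℕ => 96 * d ^ 5 := by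
      have h2 : Primrec fun d : ℕ => d * d := Primrec.nat_mul.comp Primrec.id Primrec.id
      have h4 : Primrec fun d : ℕ => d * d * (d * d) := Primrec.nat_mul.comp h2 h2
      have h5 : Primrec fun d : ℕ => 96 * (d * d * (d * d) * d) :=
        Primrec.nat_mul.comp (Primrec.const 96) (Primrec.nat_mul.comp h4 Primrec.id)
      exact h5.of_eq fun d => by ring
    exact (Primrec.nat_add.comp (Primrec.nat_mul.comp hp hp) Primrec.id).to_comp
  · intro x d t o h
    rw [eq_answerOf h]
    rcases answerOf_cases x d with ⟨n, G, rfl, rfl⟩ | ⟨h1, h2⟩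
    · rcases answerOf_encodeGraph G with ⟨h1, h2⟩ | ⟨n', G', h1, h2, h3, h4⟩
      · rw [h1]
        exact (mem_mDegreeBColoring G).2 (SimpleGraph.hasBColoring_of_card_lt h2)
      · rw [h1]
        have hn : n' ≤ 96 * G.maxDeg ^ 5 := by
          have := mDegree_pow_mul_le G
          omega
        refine ⟨?_, ?_⟩
        · rw [length_encodeGraph]
          exact Nat.add_le_add_right (Nat.mul_le_mul hn hn) _
        · rw [mem_mDegreeBColoring, h4, ← h2, mem_mDegreeBColoring]
    · rw [h1]
      exact h2

end Parameterized

theorem mainTheorem10 :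
    ∃ P : RAM.Program,
      Parameterized.IsKernelization P Parameterized.mDegreeBColoring ∧
      ∃ C : ℕ, ∀ (n : ℕ) (G : SimpleGraph (Fin n)) (t : ℕ) (x' : List Bool) (k' : ℕ),
        Parameterized.Answers P (Parameterized.encodeGraph G) G.maxDeg t
          (Parameterized.Outcome.reduced x' k') →
        ∃ (n' : ℕ) (G' : SimpleGraph (Fin n')),
          x' = Parameterized.encodeGraph G' ∧ k' = G'.maxDeg ∧
          n' ≤ C * (G.mDegree ^ 4 * G.maxDeg) ∧ n' ≤ C * G.maxDeg ^ 5 := by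
  -- The constant `96 = 6 * 16` serves both bounds: `6` suffices for the first, and `m(G) ^ 4 ≤ 16 *
  -- Δ(G) ^ 4` for `Δ(G) > 0` gives the second.
  refine ⟨Parameterized.kernelProgram, Parameterized.isKernelization_kernelProgram, 96,
    fun n G t x' k' h => ?_⟩
  have h := Parameterized.eq_answerOf h
  rcases Parameterized.answerOf_encodeGraph G with ⟨h1, -⟩ | ⟨n', G', h1, h2, h3, -⟩
  · rw [h1] at h
    cases h
  · rw [h1] at h
    obtain ⟨rfl, rfl⟩ := Parameterized.Outcome.reduced.inj h
    have := Parameterized.mDegree_pow_mul_le G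
    exact ⟨n', G', rfl, h2.symm, by omega, by omega⟩
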